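/- Let $0=r_0<r_1<r_2<\cdots$ be a strictly increasing sequence of real numbers with $\lim_{n\to\infty} r_n=\infty$ that satisfies the Müntz condition $\sum_{i=1}^{\infty} 1/r_i=\infty$, and let $0<a<1$. For $m\ge 0$ let $E(\Lambda_m)=\mathrm{span}(1,t^{r_1},\dots,t^{r_m})$, and let $(B^m_0,\dots,B^m_m)$ be its Chebyshev–Bernstein basis over $[a,1]$, i.e. the unique basis of $E(\Lambda_m)$ such that $\sum_{i=0}^m B^m_i=1$ and, for every $i$, $B^m_i$ has $i$ zeros at $a$ and $m-i$ zeros at $1$ (counted with multiplicity). For $P\in E(\Lambda_m)$, let $\eta_i(P,\Lambda_m,[a,1])$, $i=0,\dots,m$, be the Chebyshev–Bézier control points of $P$ over $[a,1]$, i.e. the coefficients in $P=\sum_{i=0}^m \eta_i(P,\Lambda_m,[a,1])\,B^m_i$. Then for every positive integer $k$, $$\lim_{m\to\infty}\ \max_{0\le i\le m}\left|\eta_i(t^{r_1},\Lambda_m,[a,1])^{r_k/r_1}-\eta_i(t^{r_k},\Lambda_m,[a,1])\right|=0,$$ where $m$ ranges over the integers $m\ge k$. -/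

import Mathlib

namespace MuntzElevation

/-- The Müntz space `E(Λ_n) = span (t ^ r 0, t ^ r 1, …, t ^ r n)`. -/
def MuntzSpace (r : ℕ → ℝ) (n : ℕ) : Submodule ℝ (ℝ → ℝ) :=
  Submodule.span ℝ (Set.range fun (i : Fin (n + 1)) (t : ℝ) => t ^ r i)

/-- The function `t ^ r k` as an element of the Müntz space `E(Λ_m)`, where `k ≤ m`. -/
noncomputable def muntzPower (r : ℕ → ℝ) {k m : ℕ} (hk : k ≤ m) : MuntzSpace r m :=
  ⟨fun t => t ^ r k, Submodule.subset_span ⟨⟨k, Nat.lt_succ_of_le hk⟩, rfl⟩⟩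

/-- `f` has a zero of multiplicity exactly `k` at `x` (no zero if `k = 0`). -/
def HasZeroOfOrder (f : ℝ → ℝ) (x : ℝ) (k : ℕ) : Prop :=
  (∀ j < k, iteratedDeriv j f x = 0) ∧ iteratedDeriv k f x ≠ 0

/-- A basis `B 0, …, B n` of `E(Λ_n)` is the Chebyshev-Bernstein basis over `[a, b]` if `B k` has
`k` zeros at `a` and `n - k` zeros at `b` (with multiplicity) for every `k`,
and it is normalized: the sum of the `B k` is the constant function `1`. -/
def IsChebyshevBernsteinBasis {r : ℕ → ℝ} {n : ℕ} (a b : ℝ)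
    (B : Module.Basis (Fin (n + 1)) ℝ (MuntzSpace r n)) : Prop :=
  (∀ k : Fin (n + 1), HasZeroOfOrder (B k : ℝ → ℝ) a k ∧
    HasZeroOfOrder (B k : ℝ → ℝ) b (n - k)) ∧
  ∀ t : ℝ, ∑ k, (B k : ℝ → ℝ) t = 1

section Existence

open Polynomial

/-- Rolle: between the points of a finite set of zeros there are enough zeros of the derivative. -/
theorem exists_deriv_zeros (g g' : ℝ → ℝ) (a b : ℝ) (ha : 0 < a)
    (hg : ∀ x, 0 < x → HasDerivAt g (g' x) x) (S : Finset ℝ)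
    (hS : ∀ x ∈ S, a ≤ x ∧ x ≤ b ∧ g x = 0) :
    ∃ T : Finset ℝ, (∀ t ∈ T, a < t ∧ g' t = 0 ∧ ∃ s ∈ S, t < s) ∧ S.card ≤ T.card + 1 := by
  classical
  induction S using Finset.induction_on_max with
  | empty => exact ⟨∅, by simp, by simp⟩
  | insert M S hM ih =>
    obtain ⟨T, hT, hc⟩ := ih (fun x hx => hS x (Finset.mem_insert_of_mem hx))
    have hMS : M ∉ S := fun h => lt_irrefl _ (hM M h)
    rcases S.eq_empty_or_nonempty with rfl | hne
    · exact ⟨∅, by simp, by simp⟩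
    have hm := S.max'_mem hne
    have h1 := hS _ (Finset.mem_insert_of_mem hm)
    have h2 := hS M (Finset.mem_insert_self _ _)
    have hlt := hM _ hm
    obtain ⟨z, hz, hz'⟩ := exists_hasDerivAt_eq_zero (f := g) (f' := g') hlt
      (fun x hx => (hg x (by linarith [hx.1])).continuousAt.continuousWithinAt)
      (by rw [h1.2.2, h2.2.2]) (fun x hx => hg x (by linarith [hx.1]))
    have hzT : z ∉ T := by
      intro h
      obtain ⟨_, _, s, hs, hts⟩ := hT z h
      have := S.le_max' s hs
      linarith [hz.1]
    refine ⟨insert z T, ?_, ?_⟩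
    · intro t ht
      rcases Finset.mem_insert.1 ht with rfl | ht
      · exact ⟨by linarith [hz.1], hz', M, Finset.mem_insert_self _ _, hz.2⟩
      · obtain ⟨h3, h4, s, hs, hts⟩ := hT t ht
        exact ⟨h3, h4, s, Finset.mem_insert_of_mem hs, hts⟩
    · rw [Finset.card_insert_of_notMem hzT, Finset.card_insert_of_notMem hMS]
      omega

/-- A real-exponent sum with too many zeros in `[a, b]`, counted with multiplicity at the end
points, has only zero coefficients. -/
theorem coeff_eq_zero_of_zeros {ι : Type*} (e : ι → ℝ) {a b : ℝ} (ha : 0 < a) (hab : a < b)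
    (s : Finset ι) : ∀ (_ : Set.InjOn e s) (c : ι → ℝ) (p q : ℕ) (Z : Finset ℝ)
    (_ : ∀ z ∈ Z, a < z ∧ z < b ∧ ∑ i ∈ s, c i * z ^ e i = 0)
    (_ : ∀ P : ℝ[X], P.degree < p → ∑ i ∈ s, c i * P.eval (e i) * a ^ e i = 0)
    (_ : ∀ P : ℝ[X], P.degree < q → ∑ i ∈ s, c i * P.eval (e i) * b ^ e i = 0)
    (_ : s.card ≤ p + q + Z.card), ∀ i ∈ s, c i = 0 := by
  classical
  induction s using Finset.induction_on with
  | empty => simp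
  | insert i0 s hi0 ih =>
    intro he c p q Z hZ hp hq hcard
    have hb : 0 < b := ha.trans hab
    have value : ∀ (x : ℝ) (m : ℕ), 0 < m →
        (∀ P : ℝ[X], P.degree < m → ∑ i ∈ insert i0 s, c i * P.eval (e i) * x ^ e i = 0) →
        ∑ i ∈ insert i0 s, c i * x ^ e i = 0 := by
      intro x m hm h
      have := h 1 (by rw [degree_one]; exact_mod_cast hm)
      simpa using this
    have twist : ∀ (x : ℝ) (m : ℕ),
        (∀ P : ℝ[X], P.degree < m → ∑ i ∈ insert i0 s, c i * P.eval (e i) * x ^ e i = 0) →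
        ∀ P : ℝ[X], P.degree < (m - 1 : ℕ) →
          ∑ i ∈ s, (c i * (e i - e i0)) * P.eval (e i) * x ^ e i = 0 := by
      intro x m h P hP
      rcases eq_or_ne P 0 with rfl | hP0
      · simp
      have hdeg : ((X - C (e i0)) * P).degree < (m : WithBot ℕ) := by
        rw [degree_mul, degree_X_sub_C, degree_eq_natDegree hP0]
        rw [degree_eq_natDegree hP0] at hP
        have : P.natDegree < m - 1 := by exact_mod_cast hP
        have : 1 + P.natDegree < m := by omega
        exact_mod_cast this
      have := h _ hdeg
      rw [Finset.sum_insert hi0] at this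
      simp only [eval_mul, eval_sub, eval_X, eval_C, sub_self, zero_mul, mul_zero, zero_add] at this
      rw [← this]
      exact Finset.sum_congr rfl fun i _ => by ring
    -- the zeros of the twisted derivative
    set S : Finset ℝ := Z ∪ ((if 0 < p then {a} else ∅) ∪ (if 0 < q then {b} else ∅)) with hSdef
    have hSz : ∀ x ∈ S, a ≤ x ∧ x ≤ b ∧ ∑ i ∈ insert i0 s, c i * x ^ e i = 0 := by
      intro x hx
      rw [hSdef, Finset.mem_union, Finset.mem_union] at hx
      rcases hx with hx | hx | hx
      · exact ⟨(hZ x hx).1.le, (hZ x hx).2.1.le, (hZ x hx).2.2⟩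
      · split_ifs at hx with h
        · rw [Finset.mem_singleton] at hx; subst hx
          exact ⟨le_rfl, hab.le, value _ p h hp⟩
        · simp at hx
      · split_ifs at hx with h
        · rw [Finset.mem_singleton] at hx; subst hx
          exact ⟨hab.le, le_rfl, value _ q h hq⟩
        · simp at hx
    have hScard : Z.card + ((if 0 < p then 1 else 0) + (if 0 < q then 1 else 0)) = S.card := by
      have hd1 : Disjoint (if 0 < p then ({a} : Finset ℝ) else ∅)
          (if 0 < q then ({b} : Finset ℝ) else ∅) := by
        split_ifs <;> simp [hab.ne]
      have hd2 : Disjoint Z ((if 0 < p then ({a} : Finset ℝ) else ∅) ∪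
          (if 0 < q then ({b} : Finset ℝ) else ∅)) := by
        rw [Finset.disjoint_left]
        intro z hz hz'
        have h1 := hZ z hz
        rw [Finset.mem_union] at hz'
        rcases hz' with h | h
        · split_ifs at h
          · rw [Finset.mem_singleton] at h; linarith [h1.1]
          · simp at h
        · split_ifs at h
          · rw [Finset.mem_singleton] at h; linarith [h1.2.1]
          · simp at h
      rw [hSdef, Finset.card_union_of_disjoint hd2, Finset.card_union_of_disjoint hd1]
      congr 2 <;> split_ifs <;> simp
    let g : ℝ → ℝ := fun x => ∑ i ∈ insert i0 s, c i * x ^ (e i - e i0)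
    have hgx : ∀ x, 0 < x → g x = x ^ (-e i0) * ∑ i ∈ insert i0 s, c i * x ^ e i := by
      intro x hx
      rw [Finset.mul_sum]
      refine Finset.sum_congr rfl fun i _ => ?_
      rw [sub_eq_neg_add, Real.rpow_add hx]; ring
    have hder : ∀ x, 0 < x →
        HasDerivAt g (∑ i ∈ insert i0 s, c i * ((e i - e i0) * x ^ (e i - e i0 - 1))) x := by
      intro x hx
      refine HasDerivAt.fun_sum fun i _ => ?_
      exact (Real.hasDerivAt_rpow_const (Or.inl hx.ne')).const_mul _
    obtain ⟨T, hT, hTc⟩ := exists_deriv_zeros g _ a b ha hder S (fun x hx => by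
      obtain ⟨h1, h2, h3⟩ := hSz x hx
      exact ⟨h1, h2, by rw [hgx x (ha.trans_le h1), h3, mul_zero]⟩)
    have hs0 : ∀ i ∈ s, c i * (e i - e i0) = 0 := by
      refine ih (he.mono (by simp)) (fun i => c i * (e i - e i0)) (p - 1) (q - 1) T
        ?_ (twist a p hp) (twist b q hq) ?_
      · intro t ht
        obtain ⟨h1, h2, x, hx, htx⟩ := hT t ht
        have ht0 : 0 < t := ha.trans h1
        refine ⟨h1, htx.trans_le (hSz x hx).2.1, ?_⟩
        rw [Finset.sum_insert hi0, sub_self, zero_mul, mul_zero, zero_add] at h2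
        have h4 : ∑ i ∈ s, c i * (e i - e i0) * t ^ e i
            = t ^ (e i0 + 1) * ∑ i ∈ s, c i * ((e i - e i0) * t ^ (e i - e i0 - 1)) := by
          rw [Finset.mul_sum]
          refine Finset.sum_congr rfl fun i _ => ?_
          have : e i = (e i0 + 1) + (e i - e i0 - 1) := by ring
          conv_lhs => rw [this, Real.rpow_add ht0]
          ring_nf
        rw [h4, h2, mul_zero]
      · rw [Finset.card_insert_of_notMem hi0] at hcard
        split_ifs at hScard <;> omega
    have hs : ∀ i ∈ s, c i = 0 := by
      intro i hi
      rcases mul_eq_zero.1 (hs0 i hi) with h | h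
      · exact h
      · exfalso
        have : i = i0 := he (by simp [hi]) (by simp) (sub_eq_zero.1 h)
        exact hi0 (this ▸ hi)
    have hSne : S.Nonempty := by
      rw [← Finset.card_pos]
      rw [Finset.card_insert_of_notMem hi0] at hcard
      split_ifs at hScard <;> omega
    obtain ⟨x, hx⟩ := hSne
    obtain ⟨h1, _, h3⟩ := hSz x hx
    rw [Finset.sum_insert hi0, Finset.sum_eq_zero (fun i hi => by rw [hs i hi, zero_mul]),
      add_zero] at h3
    have hc0 : c i0 = 0 :=
      (mul_eq_zero.1 h3).resolve_right (Real.rpow_pos_of_pos (ha.trans_le h1) _).ne'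
    intro i hi
    rcases Finset.mem_insert.1 hi with rfl | hi
    · exact hc0
    · exact hs i hi

/-- The linear combination of the powers `t ^ r i` with coefficients `c`. -/
noncomputable def powerSum (r : ℕ → ℝ) (n : ℕ) (c : Fin (n + 1) → ℝ) (t : ℝ) : ℝ :=
  ∑ i, c i * t ^ r i

theorem mem_muntzSpace_iff {r : ℕ → ℝ} {n : ℕ} {f : ℝ → ℝ} :
    f ∈ MuntzSpace r n ↔ ∃ c, powerSum r n c = f := by
  rw [MuntzSpace, Submodule.mem_span_range_iff_exists_fun]
  refine exists_congr fun c => ?_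
  have : powerSum r n c = ∑ i, c i • fun t : ℝ => t ^ r i := by
    ext t; simp [powerSum]
  rw [this]

theorem contDiffAt_rpow_const {x : ℝ} (hx : 0 < x) (s : ℝ) (m : WithTop ℕ∞) :
    ContDiffAt ℝ m (fun t : ℝ => t ^ s) x :=
  contDiffAt_id.rpow_const_of_ne hx.ne'

theorem contDiffAt_of_mem {r : ℕ → ℝ} {n : ℕ} {f : ℝ → ℝ} (hf : f ∈ MuntzSpace r n) {x : ℝ}
    (hx : 0 < x) (m : WithTop ℕ∞) : ContDiffAt ℝ m f x := by
  obtain ⟨c, rfl⟩ := mem_muntzSpace_iff.1 hf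
  exact ContDiffAt.sum fun i _ => contDiffAt_const.mul (contDiffAt_rpow_const hx _ _)

theorem iteratedDeriv_powerSum {r : ℕ → ℝ} {n : ℕ} (c : Fin (n + 1) → ℝ) {x : ℝ} (hx : 0 < x)
    (j : ℕ) : x ^ j * iteratedDeriv j (powerSum r n c) x =
      ∑ i, c i * (descPochhammer ℝ j).eval (r i) * x ^ r i := by
  have h : powerSum r n c = fun t => ∑ i, c i * t ^ r i := rfl
  rw [h, iteratedDeriv_fun_sum (fun i _ => contDiffAt_const.mul (contDiffAt_rpow_const hx _ _)),
    Finset.mul_sum]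
  refine Finset.sum_congr rfl fun i _ => ?_
  rw [iteratedDeriv_const_mul_field, iteratedDeriv_eq_iterate, Real.iter_deriv_rpow_const,
    Real.rpow_sub_natCast hx.ne']
  field_simp

/-- Vanishing to order `p` expressed through the operator `t d/dt`. -/
theorem sum_eval_eq_zero {r : ℕ → ℝ} {n : ℕ} (c : Fin (n + 1) → ℝ) {x : ℝ} (hx : 0 < x) (p : ℕ)
    (h : ∀ j < p, iteratedDeriv j (powerSum r n c) x = 0) (P : ℝ[X]) (hP : P.degree < p) :
    ∑ i, c i * P.eval (r i) * x ^ r i = 0 := by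
  induction p generalizing P with
  | zero =>
    have : P = 0 := by
      rw [← degree_eq_bot]
      simpa [Nat.WithBot.lt_zero_iff] using hP
    simp [this]
  | succ p ih =>
    set D := descPochhammer ℝ p
    have hD : D.Monic := monic_descPochhammer ℝ p
    have hDn : D.natDegree = p := descPochhammer_natDegree ℝ p
    have hle : P.degree ≤ (p : WithBot ℕ) := Order.lt_succ_iff.1 (by exact_mod_cast hP)
    have hdeg : (P - C (P.coeff p) * D).degree < p := by
      rw [degree_lt_iff_coeff_zero]
      intro m hm
      rw [coeff_sub, coeff_C_mul]
      rcases hm.eq_or_lt with rfl | hm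
      · have : D.coeff p = 1 := by rw [← hDn]; exact hD
        rw [this]; ring
      · have hDm : D.coeff m = 0 := coeff_eq_zero_of_natDegree_lt (by rw [hDn]; exact hm)
        rw [coeff_eq_zero_of_degree_lt (hle.trans_lt (by exact_mod_cast hm)), hDm]
        ring
    have h1 := ih (fun j hj => h j (by omega)) _ hdeg
    have h2 := iteratedDeriv_powerSum (r := r) c hx p
    rw [h p (by omega), mul_zero] at h2
    have : ∑ i, c i * P.eval (r i) * x ^ r i =
        ∑ i, c i * (P - C (P.coeff p) * D).eval (r i) * x ^ r i +
          P.coeff p * ∑ i, c i * D.eval (r i) * x ^ r i := by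
      rw [Finset.mul_sum, ← Finset.sum_add_distrib]
      refine Finset.sum_congr rfl fun i _ => ?_
      simp only [eval_sub, eval_mul, eval_C]; ring
    rw [this, h1, ← h2]; ring

variable {r : ℕ → ℝ} {n : ℕ} {a b : ℝ}

theorem injective_exponents (hr : StrictMono r) : Function.Injective fun i : Fin (n + 1) => r i :=
  fun _ _ h => Fin.ext (hr.injective h)

/-- A power sum with `n + 1` zeros at the end points vanishes. -/
theorem coeff_eq_zero (hr : StrictMono r) (ha : 0 < a) (hab : a < b) (c : Fin (n + 1) → ℝ)
    (p q : ℕ) (hpq : n + 1 ≤ p + q) (hp : ∀ j < p, iteratedDeriv j (powerSum r n c) a = 0)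
    (hq : ∀ j < q, iteratedDeriv j (powerSum r n c) b = 0) : c = 0 := by
  funext i
  refine coeff_eq_zero_of_zeros (fun i : Fin (n + 1) => r i) ha hab Finset.univ
    (injective_exponents hr).injOn c p q ∅ (by simp) (sum_eval_eq_zero c ha p hp)
    (sum_eval_eq_zero c (ha.trans hab) q hq) (by simpa using hpq) i (Finset.mem_univ _)

theorem eq_zero_of_mem (hr : StrictMono r) (ha : 0 < a) (hab : a < b) {f : ℝ → ℝ}
    (hf : f ∈ MuntzSpace r n) (p q : ℕ) (hpq : n + 1 ≤ p + q)
    (hp : ∀ j < p, iteratedDeriv j f a = 0) (hq : ∀ j < q, iteratedDeriv j f b = 0) : f = 0 := by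
  obtain ⟨c, rfl⟩ := mem_muntzSpace_iff.1 hf
  rw [coeff_eq_zero hr ha hab c p q hpq hp hq]
  ext t; simp [powerSum]

/-- Hermite interpolation at the end points: a function with `k` zeros at `a` and `n - k` zeros
at `b`. -/
theorem exists_hasZeroOfOrder (hr : StrictMono r) (ha : 0 < a) (hab : a < b) (k : Fin (n + 1)) :
    ∃ f : MuntzSpace r n, HasZeroOfOrder (f : ℝ → ℝ) a k ∧
      HasZeroOfOrder (f : ℝ → ℝ) b (n - k) := by
  have hb := ha.trans hab
  -- the jet of length `k + 1` at `a` and the jet of length `n - k` at `b`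
  let J : (Fin (n + 1) → ℝ) →ₗ[ℝ] (Fin (n + 1) → ℝ) :=
    { toFun := fun c j => if j ≤ k then ∑ i, c i * (descPochhammer ℝ j).eval (r i) * a ^ r i
        else ∑ i, c i * (descPochhammer ℝ (j - (k + 1))).eval (r i) * b ^ r i
      map_add' := by
        intro c d; funext j
        simp only [Pi.add_apply]
        split_ifs <;> rw [← Finset.sum_add_distrib] <;>
          exact Finset.sum_congr rfl fun i _ => by ring
      map_smul' := by
        intro c d; funext j
        simp only [Pi.smul_apply, smul_eq_mul, RingHom.id_apply]
        split_ifs <;> rw [Finset.mul_sum] <;>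
          exact Finset.sum_congr rfl fun i _ => by ring }
  have hJa : ∀ c (j : ℕ) (hj : j ≤ k),
      J c ⟨j, by omega⟩ = a ^ j * iteratedDeriv j (powerSum r n c) a := by
    intro c j hj
    rw [iteratedDeriv_powerSum c ha]
    exact if_pos (Fin.le_def.2 hj)
  have hJb : ∀ c (j : ℕ) (hj : j < n - k),
      J c ⟨j + (k + 1), by omega⟩ = b ^ j * iteratedDeriv j (powerSum r n c) b := by
    intro c j hj
    rw [iteratedDeriv_powerSum c hb]
    have h1 : ¬ ((⟨j + (k + 1), by omega⟩ : Fin (n + 1)) ≤ k) := by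
      rw [Fin.le_def]; simp only; omega
    refine (if_neg h1).trans ?_
    simp only [Nat.add_sub_cancel]
  have hinj : Function.Injective J := by
    rw [← LinearMap.ker_eq_bot, LinearMap.ker_eq_bot']
    intro c hc
    refine coeff_eq_zero hr ha hab c (k + 1) (n - k) (by omega) (fun j hj => ?_) (fun j hj => ?_)
    · have := hJa c j (by omega)
      rw [hc] at this
      exact (mul_eq_zero.1 this.symm).resolve_left (pow_pos ha j).ne'
    · have := hJb c j hj
      rw [hc] at this
      exact (mul_eq_zero.1 this.symm).resolve_left (pow_pos hb j).ne'
  obtain ⟨c, hc⟩ := (LinearMap.injective_iff_surjective.1 hinj) (Pi.single k 1)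
  have hmem : powerSum r n c ∈ MuntzSpace r n := mem_muntzSpace_iff.2 ⟨c, rfl⟩
  have hva : ∀ j < (k : ℕ), iteratedDeriv j (powerSum r n c) a = 0 := by
    intro j hj
    have := hJa c j hj.le
    rw [hc, Pi.single_eq_of_ne (by rw [Ne, Fin.ext_iff]; exact hj.ne)] at this
    exact (mul_eq_zero.1 this.symm).resolve_left (pow_pos ha j).ne'
  have hvb : ∀ j < n - (k : ℕ), iteratedDeriv j (powerSum r n c) b = 0 := by
    intro j hj
    have := hJb c j hj
    rw [hc, Pi.single_eq_of_ne (by rw [Ne, Fin.ext_iff]; simp only; omega)] at this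
    exact (mul_eq_zero.1 this.symm).resolve_left (pow_pos hb j).ne'
  have hne : iteratedDeriv k (powerSum r n c) a ≠ 0 := by
    intro h0
    have := hJa c k le_rfl
    rw [hc, h0, mul_zero] at this
    simp at this
  refine ⟨⟨_, hmem⟩, ⟨hva, hne⟩, hvb, fun h0 => hne ?_⟩
  have : powerSum r n c = 0 := by
    refine eq_zero_of_mem hr ha hab hmem k (n - k + 1) (by omega) hva fun j hj => ?_
    rcases Nat.lt_succ_iff_lt_or_eq.1 hj with h | rfl
    · exact hvb j h
    · exact h0
  rw [this]
  simp

theorem iteratedDeriv_sum_smul (f : Fin (n + 1) → MuntzSpace r n) (w : Fin (n + 1) → ℝ)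
    (s : Finset (Fin (n + 1))) {x : ℝ} (hx : 0 < x) (j : ℕ) :
    iteratedDeriv j ((∑ i ∈ s, w i • f i : MuntzSpace r n) : ℝ → ℝ) x =
      ∑ i ∈ s, w i * iteratedDeriv j (f i : ℝ → ℝ) x := by
  have h : ((∑ i ∈ s, w i • f i : MuntzSpace r n) : ℝ → ℝ) =
      fun t => ∑ i ∈ s, w i * (f i : ℝ → ℝ) t := by
    ext t; simp
  rw [h, iteratedDeriv_fun_sum
    (fun i _ => contDiffAt_const.mul (contDiffAt_of_mem (f i).2 hx _))]
  exact Finset.sum_congr rfl fun i _ => iteratedDeriv_const_mul_field _ _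

theorem linearIndependent_of_zeros (ha : 0 < a) (f : Fin (n + 1) → MuntzSpace r n)
    (hf : ∀ k : Fin (n + 1), HasZeroOfOrder (f k : ℝ → ℝ) a k) : LinearIndependent ℝ f := by
  rw [Fintype.linearIndependent_iff]
  intro w hw
  by_contra! hne
  obtain ⟨k, hk, hmin⟩ : ∃ k, w k ≠ 0 ∧ ∀ j < k, w j = 0 := by
    classical
    obtain ⟨k, hk, hmin⟩ := WellFounded.has_min (wellFounded_lt (α := Fin (n + 1)))
      {k | w k ≠ 0} hne
    exact ⟨k, hk, fun j hj => by by_contra h; exact hmin j h hj⟩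
  have h := iteratedDeriv_sum_smul f w Finset.univ ha k
  rw [hw, Finset.sum_eq_single k] at h
  · have h0 : iteratedDeriv k ((0 : MuntzSpace r n) : ℝ → ℝ) a = 0 := by simp
    rw [h0] at h
    exact mul_ne_zero hk (hf k).2 h.symm
  · intro j _ hj
    rcases lt_or_gt_of_ne hj with hlt | hgt
    · rw [hmin j hlt, zero_mul]
    · rw [(hf j).1 k hgt, mul_zero]
  · simp

theorem linearIndependent_powers (hr : StrictMono r) :
    LinearIndependent ℝ fun (i : Fin (n + 1)) (t : ℝ) => t ^ r i := by
  rw [Fintype.linearIndependent_iff]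
  intro c hc
  have : powerSum r n c = 0 := by
    rw [← hc]; ext t; simp [powerSum]
  have := coeff_eq_zero (a := 1) (b := 2) hr one_pos one_lt_two c (n + 1) 0 le_rfl
    (by intro j _; rw [this]; simp) (by simp)
  intro i; rw [this]; rfl

theorem finrank_muntzSpace (hr : StrictMono r) : Module.finrank ℝ (MuntzSpace r n) = n + 1 :=
  (finrank_span_eq_card (linearIndependent_powers (n := n) hr)).trans (by simp)

/-- The derivative of a nonconstant function of the Müntz space has at most `n - 1` zeros. -/
theorem sum_ne_one (h0 : r 0 = 0) (hr : StrictMono r) (ha : 0 < a) (hab : a < b)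
    (f g : MuntzSpace r n) (k : ℕ) (hk : k ≤ n)
    (hf : ∀ j < n - k + 1, iteratedDeriv j (f : ℝ → ℝ) b = 0)
    (hg : ∀ j < k + 1, iteratedDeriv j (g : ℝ → ℝ) a = 0) :
    ¬ ∀ t : ℝ, (f : ℝ → ℝ) t + (g : ℝ → ℝ) t = 1 := by
  intro hfg
  have hb := ha.trans hab
  obtain ⟨c, hc⟩ := mem_muntzSpace_iff.1 f.2
  obtain ⟨d, hd⟩ := mem_muntzSpace_iff.1 g.2
  rw [← hc] at hf hfg
  rw [← hd] at hg hfg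
  have hcd : c + d = Pi.single 0 1 := by
    have hlin := linearIndependent_powers (n := n) hr
    rw [Fintype.linearIndependent_iff] at hlin
    have := hlin (c + d - Pi.single 0 1) (by
      ext t
      have := hfg t
      simp only [powerSum] at this
      simp only [Pi.sub_apply, Pi.add_apply, Finset.sum_apply, Pi.smul_apply, smul_eq_mul,
        sub_mul, add_mul, Finset.sum_sub_distrib, Finset.sum_add_distrib, this]
      simp [Pi.single_apply, h0])
    funext i
    have h := this i
    simp only [Pi.sub_apply] at h
    linarith
  have hcd' : ∀ i, i ≠ 0 → d i = -c i := by
    intro i hi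
    have := congrFun hcd i
    rw [Pi.add_apply, Pi.single_eq_of_ne hi] at this
    linarith
  have hXdeg : ∀ (P : ℝ[X]) (m : ℕ), P.degree < (m : WithBot ℕ) → (P * X).degree < ((m + 1 : ℕ) : WithBot ℕ) := by
    intro P m hP
    rcases eq_or_ne P 0 with rfl | hP0
    · simp
    rw [degree_mul, degree_X, degree_eq_natDegree hP0]
    rw [degree_eq_natDegree hP0] at hP
    have : P.natDegree < m := by exact_mod_cast hP
    have : P.natDegree + 1 < m + 1 := by omega
    exact_mod_cast this
  have herase : ∀ F : Fin (n + 1) → ℝ, F 0 = 0 →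
      ∑ i ∈ Finset.univ.erase 0, F i = ∑ i, F i := by
    intro F hF
    exact Finset.sum_erase _ hF
  have hzero := coeff_eq_zero_of_zeros (fun i : Fin (n + 1) => r i) ha hab
    (Finset.univ.erase 0) (injective_exponents hr).injOn (fun i => c i * r i) k (n - k) ∅
    (by simp) (fun P hP => by
      have h1 := sum_eval_eq_zero d ha (k + 1) hg (P * X) (hXdeg P k hP)
      rw [herase _ (by simp [h0]), ← neg_eq_zero, ← h1, ← Finset.sum_neg_distrib]
      refine Finset.sum_congr rfl fun i _ => ?_
      simp only [eval_mul, eval_X]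
      rcases eq_or_ne i 0 with rfl | hi
      · simp [h0]
      · rw [hcd' i hi]; ring)
    (fun P hP => by
      have h1 := sum_eval_eq_zero c hb (n - k + 1) hf (P * X) (hXdeg P _ hP)
      rw [herase _ (by simp [h0]), ← h1]
      refine Finset.sum_congr rfl fun i _ => ?_
      simp only [eval_mul, eval_X]; ring)
    (by simp; omega)
  have hc0 : ∀ i, i ≠ 0 → c i = 0 := by
    intro i hi
    refine (mul_eq_zero.1 (hzero i (by simp [hi]))).resolve_right ?_
    have : r 0 < r i := hr (Nat.pos_of_ne_zero fun h => hi (Fin.ext h))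
    rw [h0] at this
    exact this.ne'
  have hfb := hf 0 (by omega)
  have hga := hg 0 (by omega)
  rw [iteratedDeriv_zero, powerSum, Finset.sum_eq_single 0
    (fun i _ hi => by rw [hc0 i hi, zero_mul]) (by simp)] at hfb
  rw [iteratedDeriv_zero, powerSum, Finset.sum_eq_single 0
    (fun i _ hi => by rw [hcd' i hi, hc0 i hi, neg_zero, zero_mul]) (by simp)] at hga
  have := congrFun hcd 0
  simp [h0] at hfb hga this
  linarith

/-- The Chebyshev-Bernstein basis of a Müntz space over `[a, b]` exists and is unique. -/
theorem existsUnique_chebyshevBernsteinBasis (h0 : r 0 = 0) (hr : StrictMono r) (ha : 0 < a)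
    (hab : a < b) (n : ℕ) :
    ∃! B : Module.Basis (Fin (n + 1)) ℝ (MuntzSpace r n), IsChebyshevBernsteinBasis a b B := by
  have hb := ha.trans hab
  have hone : (fun _ => 1 : ℝ → ℝ) ∈ MuntzSpace r n :=
    Submodule.subset_span ⟨0, by ext t; simp [h0]⟩
  have existence : ∃ B : Module.Basis (Fin (n + 1)) ℝ (MuntzSpace r n),
      IsChebyshevBernsteinBasis a b B := by
    choose f hfa hfb using fun k : Fin (n + 1) => exists_hasZeroOfOrder hr ha hab k
    let B0 := basisOfLinearIndependentOfCardEqFinrank (linearIndependent_of_zeros ha f hfa)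
      (by rw [finrank_muntzSpace hr]; simp)
    have hB0 : ∀ k, B0 k = f k := fun k => by simp [B0]
    let w : Fin (n + 1) → ℝ := fun k => B0.repr ⟨_, hone⟩ k
    have hsum : ∑ k, w k • f k = ⟨_, hone⟩ := by
      have := B0.sum_repr ⟨_, hone⟩
      simpa only [hB0] using this
    have hsum' : ∀ t, ∑ k, w k * (f k : ℝ → ℝ) t = 1 := by
      intro t
      have := congrArg (fun F : MuntzSpace r n => (F : ℝ → ℝ) t) hsum
      simpa using this
    have hw : ∀ k, w k ≠ 0 := by
      intro k hk
      refine sum_ne_one h0 hr ha hab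
        (∑ i ∈ Finset.univ.filter (· < k), w i • f i)
        (∑ i ∈ Finset.univ.filter (¬ · < k), w i • f i) k (by omega) ?_ ?_ ?_
      · intro j hj
        rw [iteratedDeriv_sum_smul _ _ _ hb]
        refine Finset.sum_eq_zero fun i hi => ?_
        have hik : (i : ℕ) < k := (Finset.mem_filter.1 hi).2
        rw [(hfb i).1 j (by omega), mul_zero]
      · intro j hj
        rw [iteratedDeriv_sum_smul _ _ _ ha]
        refine Finset.sum_eq_zero fun i hi => ?_
        have hik : ¬ i < k := (Finset.mem_filter.1 hi).2
        rcases eq_or_ne i k with rfl | hne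
        · rw [hk, zero_mul]
        · have : (k : ℕ) < i := lt_of_le_of_ne (not_lt.1 hik) (fun h => hne (Fin.ext h.symm))
          rw [(hfa i).1 j (by omega), mul_zero]
      · intro t
        rw [← hsum' t, ← Finset.sum_filter_add_sum_filter_not Finset.univ (· < k)]
        simp
    refine ⟨B0.isUnitSMul fun k => (hw k).isUnit, fun k => ?_, fun t => ?_⟩
    · have hcoe : ((B0.isUnitSMul (fun k => (hw k).isUnit) k : MuntzSpace r n) : ℝ → ℝ) =
          fun t => w k * (f k : ℝ → ℝ) t := by
        rw [Module.Basis.isUnitSMul_apply, hB0]; ext t; simp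
      rw [hcoe]
      refine ⟨⟨fun j hj => ?_, ?_⟩, fun j hj => ?_, ?_⟩
      · rw [iteratedDeriv_const_mul_field, (hfa k).1 j hj, mul_zero]
      · rw [iteratedDeriv_const_mul_field]; exact mul_ne_zero (hw k) (hfa k).2
      · rw [iteratedDeriv_const_mul_field, (hfb k).1 j hj, mul_zero]
      · rw [iteratedDeriv_const_mul_field]; exact mul_ne_zero (hw k) (hfb k).2
    · rw [← hsum' t]
      refine Finset.sum_congr rfl fun k _ => ?_
      rw [Module.Basis.isUnitSMul_apply, hB0]; simp
  obtain ⟨B, hB⟩ := existence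
  refine ⟨B, hB, fun B' hB' => ?_⟩
  have key : ∀ k, ∃ l : ℝ, B' k = l • B k := by
    intro k
    refine ⟨iteratedDeriv k (B' k : ℝ → ℝ) a / iteratedDeriv k (B k : ℝ → ℝ) a, ?_⟩
    set l := iteratedDeriv k (B' k : ℝ → ℝ) a / iteratedDeriv k (B k : ℝ → ℝ) a with hl
    have hit : ∀ x, 0 < x → ∀ j, iteratedDeriv j ((B' k - l • B k : MuntzSpace r n) : ℝ → ℝ) x =
        iteratedDeriv j (B' k : ℝ → ℝ) x - l * iteratedDeriv j (B k : ℝ → ℝ) x := by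
      intro x hx j
      have : ((B' k - l • B k : MuntzSpace r n) : ℝ → ℝ) =
          fun t => (B' k : ℝ → ℝ) t - l * (B k : ℝ → ℝ) t := by ext t; simp
      rw [this, iteratedDeriv_fun_sub (contDiffAt_of_mem (B' k).2 hx _)
        (contDiffAt_const.mul (contDiffAt_of_mem (B k).2 hx _)), iteratedDeriv_const_mul_field]
    have hz := eq_zero_of_mem hr ha hab (B' k - l • B k).2 (k + 1) (n - k) (by omega)
      (fun j hj => by
        rw [hit a ha]
        rcases Nat.lt_succ_iff_lt_or_eq.1 hj with h | rfl
        · rw [(hB'.1 k).1.1 j h, (hB.1 k).1.1 j h]; ring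
        · rw [hl, div_mul_cancel₀ _ (hB.1 k).1.2, sub_self])
      (fun j hj => by
        rw [hit b hb, (hB'.1 k).2.1 j hj, (hB.1 k).2.1 j hj]; ring)
    exact sub_eq_zero.1 (Subtype.ext hz)
  choose l hl using key
  have hlin := Fintype.linearIndependent_iff.1 B.linearIndependent (fun k => l k - 1) (by
    apply Subtype.ext
    ext t
    have h1 := hB.2 t
    have h2 := hB'.2 t
    simp only [hl] at h2
    simp only [sub_smul, one_smul, Finset.sum_sub_distrib]
    simp at h1 h2 ⊢
    rw [h1, h2, sub_self])
  refine Module.Basis.eq_of_apply_eq fun k => ?_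
  rw [hl k, sub_eq_zero.1 (hlin k), one_smul]

end Existence

/-- The Chebyshev-Bernstein basis of `E(Λ_n)` over `[a, b]`, `0 < a < b`. -/
noncomputable def chebyshevBernsteinBasis {r : ℕ → ℝ} (h0 : r 0 = 0) (hr : StrictMono r)
    {a b : ℝ} (ha : 0 < a) (hab : a < b) (n : ℕ) :
    Module.Basis (Fin (n + 1)) ℝ (MuntzSpace r n) :=
  (existsUnique_chebyshevBernsteinBasis h0 hr ha hab n).choose

theorem isChebyshevBernsteinBasis {r : ℕ → ℝ} (h0 : r 0 = 0) (hr : StrictMono r)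
    {a b : ℝ} (ha : 0 < a) (hab : a < b) (n : ℕ) :
    IsChebyshevBernsteinBasis a b (chebyshevBernsteinBasis h0 hr ha hab n) :=
  (existsUnique_chebyshevBernsteinBasis h0 hr ha hab n).choose_spec.1

/-- The Chebyshev-Bézier control points `η_0, …, η_n` of `P ∈ E(Λ_n)` over `[a, b]`: the
coefficients in `P = ∑ i, η_i • B_i`, with `B` the Chebyshev-Bernstein basis over `[a, b]`. -/
noncomputable def controlPoint {r : ℕ → ℝ} (h0 : r 0 = 0) (hr : StrictMono r)
    {a b : ℝ} (ha : 0 < a) (hab : a < b) {n : ℕ} (P : MuntzSpace r n) (i : Fin (n + 1)) : ℝ :=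
  (chebyshevBernsteinBasis h0 hr ha hab n).repr P i

end MuntzElevation

/-!
The control points of `t ^ s` over `[a, b]` are `b ^ s * q i s`, where `q i` is the numerator, of
degree `m - i` and normalized by `q i 0 = 1`, of the rational interpolant of type `(m - i, i)` of
`s ↦ (a / b) ^ s` at the exponents `r 0, …, r m`. By Rolle's theorem the numerators are positive at
the exponents; applied to divided differences of consecutive numerators, this shows that the
control polygon of the curve `(t ^ r j, t ^ r k)` is convex. Since the Chebyshev–Bernstein functions
are positive, Jensen's inequality then bounds the control point of `t ^ r k` by the power
`r k / r j` of that of `t ^ r j`.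

Conversely, corner cutting writes `q i` as a convex combination of the polynomials
`∏ (1 - X / r n)`, `l < n ≤ m`. By convexity the defect in Jensen's inequality is at most the
defect of one of these corners. The latter tends to `0` uniformly in `l`: for small `l` the Müntz
condition sends both of its terms to `0`, and for large `l` the factors are nearly exponentials, for
which there is no defect.
-/

namespace MuntzElevation

open Polynomial Filter Topology

section DegreeLT

variable {R : Type*} [Semiring R] {p : R[X]} {n : ℕ}

theorem mem_degreeLT_iff_coeff : p ∈ degreeLT R n ↔ ∀ m, n ≤ m → p.coeff m = 0 := by
  rw [mem_degreeLT, degree_lt_iff_coeff_zero]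

theorem mem_degreeLT_of_coeff_eq_zero (hp : p ∈ degreeLT R (n + 1)) (h : p.coeff n = 0) :
    p ∈ degreeLT R n := by
  rw [mem_degreeLT_iff_coeff] at *
  intro m hm
  rcases hm.eq_or_lt with rfl | hm
  · exact h
  · exact hp m hm

theorem iterate_derivative_eq_C (hp : p ∈ degreeLT R (n + 1)) :
    derivative^[n] p = C (n.factorial * p.coeff n) := by
  rw [mem_degreeLT_iff_coeff] at hp
  ext m
  rw [coeff_iterate_derivative, coeff_C]
  split_ifs with hm
  · simp [hm, Nat.descFactorial_self]
  · rw [hp _ (by omega), smul_zero]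

theorem eq_C_of_mem_degreeLT_one (hp : p ∈ degreeLT R 1) : p = C (p.coeff 0) := by
  rw [mem_degreeLT_iff_coeff] at hp
  exact eq_C_of_degree_le_zero <| (degree_le_iff_coeff_zero p 0).2 fun m hm =>
    hp m (by exact_mod_cast hm)

theorem exists_mem_degreeLT_eq_X_sub_C_mul {R : Type*} [CommRing R] [IsDomain R] {p : R[X]} {x : R}
    (hp : p ∈ degreeLT R (n + 1)) (hx : p.eval x = 0) :
    ∃ g ∈ degreeLT R n, p = (X - C x) * g := by
  obtain ⟨g, rfl⟩ := dvd_iff_isRoot.2 hx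
  refine ⟨g, ?_, rfl⟩
  rcases eq_or_ne g 0 with rfl | hg
  · exact zero_mem _
  rw [mem_degreeLT, degree_mul, degree_X_sub_C, degree_eq_natDegree hg] at hp
  rw [mem_degreeLT, degree_eq_natDegree hg]
  have : 1 + g.natDegree < n + 1 := by exact_mod_cast hp
  exact_mod_cast (by omega : g.natDegree < n)

end DegreeLT

section ExpDeriv

theorem exists_deriv_zeros_line (g g' : ℝ → ℝ) (hg : ∀ x, HasDerivAt g (g' x) x) (S : Finset ℝ)
    (hS : ∀ x ∈ S, g x = 0) :
    ∃ T : Finset ℝ, (∀ t ∈ T, g' t = 0) ∧ S.card ≤ T.card + 1 := by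
  classical
  obtain ⟨A, hA⟩ := S.bddBelow
  obtain ⟨B, hB⟩ := S.bddAbove
  obtain ⟨T, hT, hcard⟩ := exists_deriv_zeros (fun x => g (x - (1 - A))) (fun x => g' (x - (1 - A)))
    1 (B + (1 - A)) one_pos (fun x _ => (hg _).comp_sub_const x _)
    (S.image fun x => x + (1 - A)) (by
      rw [Finset.forall_mem_image]
      refine fun x hx => ⟨?_, ?_, by simpa using hS x hx⟩
      · linarith [hA (Finset.mem_coe.2 hx)]
      · linarith [hB (Finset.mem_coe.2 hx)])
  refine ⟨T.image fun x => x - (1 - A), ?_, ?_⟩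
  · rw [Finset.forall_mem_image]
    exact fun x hx => (hT x hx).2.1
  · rwa [Finset.card_image_of_injective _ (add_left_injective _),
      ← Finset.card_image_of_injective T (sub_left_injective (b := 1 - A))] at hcard

/-- The first-order operator `p ↦ p' + (log c) p` on polynomials. It is the derivative of
`x ↦ c ^ x * p x` with the factor `c ^ x` removed. -/
noncomputable def expDeriv (c : ℝ) (p : ℝ[X]) : ℝ[X] := derivative p + C (Real.log c) * p

variable {c : ℝ} {p q : ℝ[X]} {d i n : ℕ}

theorem hasDerivAt_rpow_mul_eval (hc : 0 < c) (p : ℝ[X]) (x : ℝ) :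
    HasDerivAt (fun x => c ^ x * p.eval x) (c ^ x * (expDeriv c p).eval x) x := by
  refine (((hasDerivAt_id x).const_rpow (f := fun x => x) hc).mul (p.hasDerivAt x)).congr_deriv ?_
  simp only [expDeriv, eval_add, eval_mul, eval_C]
  ring

theorem iterate_expDeriv_mem_degreeLT (hp : p ∈ degreeLT ℝ n) (m : ℕ) :
    (expDeriv c)^[m] p ∈ degreeLT ℝ n := by
  induction m with
  | zero => exact hp
  | succ m ih =>
    rw [Function.iterate_succ_apply']
    rw [mem_degreeLT_iff_coeff] at ih ⊢
    intro l hl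
    simp [expDeriv, coeff_derivative, ih l hl, ih (l + 1) (by omega)]

theorem coeff_iterate_expDeriv (hp : p ∈ degreeLT ℝ (n + 1)) (m : ℕ) :
    ((expDeriv c)^[m] p).coeff n = Real.log c ^ m * p.coeff n := by
  induction m with
  | zero => simp
  | succ m ih =>
    have hn := mem_degreeLT_iff_coeff.1 (iterate_expDeriv_mem_degreeLT (c := c) hp m) _ le_rfl
    rw [Function.iterate_succ_apply', expDeriv, coeff_add, coeff_derivative, hn, coeff_C_mul, ih]
    ring

theorem iterate_expDeriv_C (c a : ℝ) (m : ℕ) :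
    (expDeriv c)^[m] (C a) = C (Real.log c ^ m * a) := by
  induction m with
  | zero => simp
  | succ m ih => simp [Function.iterate_succ_apply', ih, expDeriv, pow_succ', mul_assoc]

theorem eq_zero_of_iterate_expDeriv_eq_zero (hc : Real.log c ≠ 0) {m : ℕ}
    (h : (expDeriv c)^[m] p = 0) : p = 0 := by
  by_contra hp
  have hlead := coeff_iterate_expDeriv (c := c) (p := p) (n := p.natDegree)
    (mem_degreeLT.2 (by rw [degree_eq_natDegree hp]; exact_mod_cast Nat.lt_succ_self _)) m
  rw [h, coeff_zero, coeff_natDegree] at hlead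
  exact mul_ne_zero (pow_ne_zero m hc) (leadingCoeff_ne_zero.2 hp) hlead.symm

theorem exists_eval_iterate_derivative_eq (hc : 0 < c) (q p : ℝ[X]) (S : Finset ℝ)
    (h : ∀ x ∈ S, q.eval x = c ^ x * p.eval x) (n : ℕ) :
    ∃ T : Finset ℝ, (∀ x ∈ T, (derivative^[n] q).eval x = c ^ x * ((expDeriv c)^[n] p).eval x) ∧
      S.card ≤ T.card + n := by
  induction n with
  | zero => exact ⟨S, h, le_rfl⟩
  | succ n ih =>
    obtain ⟨T, hT, hcard⟩ := ih
    obtain ⟨U, hU, hcard'⟩ := exists_deriv_zeros_line _ _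
      (fun x => ((derivative^[n] q).hasDerivAt x).sub (hasDerivAt_rpow_mul_eval hc _ x))
      T (fun x hx => sub_eq_zero.2 (hT x hx))
    refine ⟨U, fun x hx => ?_, by omega⟩
    rw [Function.iterate_succ_apply', Function.iterate_succ_apply']
    exact sub_eq_zero.1 (hU x hx)

theorem eq_zero_of_eval_eq_rpow_mul (hc : 0 < c) (hc1 : c ≠ 1) {S : Finset ℝ} {e : ℕ}
    (hq : q ∈ degreeLT ℝ d) (hp : p ∈ degreeLT ℝ e) (hS : d + e ≤ S.card)
    (h : ∀ x ∈ S, q.eval x = c ^ x * p.eval x) : q = 0 ∧ p = 0 := by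
  obtain ⟨T, hT, hcard⟩ := exists_eval_iterate_derivative_eq hc q p S h d
  have hder : derivative^[d] q = 0 := by
    ext m
    rw [coeff_iterate_derivative, mem_degreeLT_iff_coeff.1 hq _ (by omega), smul_zero, coeff_zero]
  have hlog : Real.log c ≠ 0 := Real.log_ne_zero_of_pos_of_ne_one hc hc1
  have hp0 : p = 0 := eq_zero_of_iterate_expDeriv_eq_zero hlog (m := d) <|
    eq_zero_of_degree_lt_of_eval_finset_eq_zero T
      ((mem_degreeLT.1 (iterate_expDeriv_mem_degreeLT hp d)).trans_le
        (by exact_mod_cast (by omega)))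
      fun x hx => by simpa [hder, (Real.rpow_pos_of_pos hc x).ne'] using (hT x hx).symm
  refine ⟨eq_zero_of_degree_lt_of_eval_finset_eq_zero S
    ((mem_degreeLT.1 hq).trans_le (by exact_mod_cast (by omega))) fun x hx => ?_, hp0⟩
  rw [h x hx, hp0, eval_zero, mul_zero]

end ExpDeriv

/-- The polynomials `q` and `p`, of degrees at most `d` and `i`, solve the linearized rational
interpolation problem `q / p = c ^ x` at the nodes `x ∈ S`. -/
structure IsExpInterpolant (c : ℝ) (S : Finset ℝ) (d i : ℕ) (q p : ℝ[X]) : Prop where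
  num_mem : q ∈ degreeLT ℝ (d + 1)
  den_mem : p ∈ degreeLT ℝ (i + 1)
  eval_eq : ∀ x ∈ S, q.eval x = c ^ x * p.eval x

namespace IsExpInterpolant

variable {c : ℝ} {S T : Finset ℝ} {d i d' i' : ℕ} {q p q' p' : ℝ[X]} {x y : ℝ}

theorem smul (h : IsExpInterpolant c S d i q p) (t : ℝ) :
    IsExpInterpolant c S d i (t • q) (t • p) :=
  ⟨Submodule.smul_mem _ _ h.1, Submodule.smul_mem _ _ h.2, fun x hx => by
    rw [eval_smul, eval_smul, h.3 x hx, smul_eq_mul, smul_eq_mul, mul_left_comm]⟩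

theorem sub (h : IsExpInterpolant c S d i q p) (h' : IsExpInterpolant c S d i q' p') :
    IsExpInterpolant c S d i (q - q') (p - p') :=
  ⟨sub_mem h.1 h'.1, sub_mem h.2 h'.2, fun x hx => by
    rw [eval_sub, eval_sub, h.3 x hx, h'.3 x hx, mul_sub]⟩

theorem mono (h : IsExpInterpolant c S d i q p) (hT : T ⊆ S) (hd : d ≤ d') (hi : i ≤ i') :
    IsExpInterpolant c T d' i' q p :=
  ⟨degreeLT_mono (by omega) h.1, degreeLT_mono (by omega) h.2, fun x hx => h.3 x (hT hx)⟩

theorem exists_coeff_eq (h : IsExpInterpolant c S d i q p) (hc : 0 < c) (hc1 : c < 1)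
    (hS : d + i + 1 ≤ S.card) : ∃ κ : ℝ, 0 < κ ∧ p.coeff i = κ * ((-1) ^ d * q.coeff d) := by
  -- Differentiating `q - c ^ x p` `d` times and then `c⁻¹ ^ x q - p` `i` times leaves constants.
  obtain ⟨T, hT, hcard⟩ := exists_eval_iterate_derivative_eq hc q p S h.eval_eq d
  rw [iterate_derivative_eq_C h.num_mem] at hT
  obtain ⟨U, hU, hcard'⟩ := exists_eval_iterate_derivative_eq (inv_pos.2 hc) ((expDeriv c)^[d] p)
    (C (d.factorial * q.coeff d)) T (fun x hx => by
      rw [hT x hx, Real.inv_rpow hc.le, inv_mul_cancel_left₀ (Real.rpow_pos_of_pos hc x).ne']) i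
  obtain ⟨z, hz⟩ : U.Nonempty := by rw [← Finset.card_pos]; omega
  have hz := hU z hz
  rw [iterate_derivative_eq_C (iterate_expDeriv_mem_degreeLT h.den_mem d),
    coeff_iterate_expDeriv h.den_mem, iterate_expDeriv_C, eval_C, eval_C, Real.log_inv] at hz
  obtain ⟨L, hL, hlog⟩ : ∃ L, 0 < L ∧ Real.log c = -L :=
    ⟨-Real.log c, neg_pos.2 (Real.log_neg hc hc1), (neg_neg _).symm⟩
  rw [hlog, neg_neg, neg_pow L] at hz
  refine ⟨c⁻¹ ^ z * L ^ i * d.factorial / (i.factorial * L ^ d), by positivity, ?_⟩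
  have hsq : ((-1 : ℝ) ^ d) * (-1) ^ d = 1 := by rw [← mul_pow]; simp
  rw [div_mul_eq_mul_div, eq_div_iff (by positivity)]
  linear_combination (-1) ^ d * hz - i.factorial * L ^ d * p.coeff i * hsq

theorem den_coeff_pos_iff (h : IsExpInterpolant c S d i q p) (hc : 0 < c) (hc1 : c < 1)
    (hS : d + i + 1 ≤ S.card) : 0 < p.coeff i ↔ 0 < (-1) ^ d * q.coeff d := by
  obtain ⟨κ, hκ, hcoeff⟩ := h.exists_coeff_eq hc hc1 hS
  rw [hcoeff, mul_pos_iff_of_pos_left hκ]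

theorem eq_zero_of_den_coeff_eq_zero (h : IsExpInterpolant c S d i q p) (hc : 0 < c) (hc1 : c ≠ 1)
    (hS : d + i + 1 ≤ S.card) (h0 : p.coeff i = 0) : q = 0 ∧ p = 0 :=
  eq_zero_of_eval_eq_rpow_mul hc hc1 h.1 (mem_degreeLT_of_coeff_eq_zero h.2 h0) (by omega) h.3

theorem exists_den_coeff_eq_one (hc : 0 < c) (hc1 : c ≠ 1) (hS : S.card = d + i + 1) :
    ∃ q p, IsExpInterpolant c S d i q p ∧ p.coeff i = 1 := by
  let residual : (degreeLT ℝ (d + 1) × degreeLT ℝ (i + 1)) →ₗ[ℝ] (S → ℝ) :=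
    { toFun := fun f x => (f.1 : ℝ[X]).eval (x : ℝ) - c ^ (x : ℝ) * (f.2 : ℝ[X]).eval (x : ℝ)
      map_add' := by intro f g; ext x; simp; ring
      map_smul' := by intro t f; ext x; simp; ring }
  have hfin : ∀ n, Module.finrank ℝ (degreeLT ℝ n) = n := fun n => by
    rw [(degreeLTEquiv ℝ n).finrank_eq, Module.finrank_fin_fun]
  have : ∀ n, Module.Finite ℝ (degreeLT ℝ n) := fun n =>
    Module.Finite.equiv (degreeLTEquiv ℝ n).symm
  have hker : LinearMap.ker residual ≠ ⊥ := LinearMap.ker_ne_bot_of_finrank_lt (by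
    rw [Module.finrank_prod, hfin, hfin, Module.finrank_fintype_fun_eq_card, Fintype.card_coe]
    omega)
  obtain ⟨f, hf, hf0⟩ := Submodule.exists_mem_ne_zero_of_ne_bot hker
  have h : IsExpInterpolant c S d i f.1 f.2 := ⟨f.1.2, f.2.2, fun x hx =>
    sub_eq_zero.1 (congrFun (LinearMap.mem_ker.1 hf) ⟨x, hx⟩)⟩
  have hcoeff : (f.2 : ℝ[X]).coeff i ≠ 0 := fun h0 => hf0 <| by
    obtain ⟨h1, h2⟩ := h.eq_zero_of_den_coeff_eq_zero hc hc1 hS.ge h0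
    exact Prod.ext (Subtype.ext h1) (Subtype.ext h2)
  exact ⟨_, _, h.smul ((f.2 : ℝ[X]).coeff i)⁻¹, by simp [hcoeff]⟩

theorem exists_eq_add (h : IsExpInterpolant c S (d + 1) (i + 1) q p) (hc : 0 < c) (hc1 : c < 1)
    (hS : d + i + 3 ≤ S.card) (hp : 0 < p.coeff (i + 1)) (hT : T ⊆ S)
    (hTcard : T.card = d + i + 2) :
    ∃ f g f' g', IsExpInterpolant c T d (i + 1) f g ∧ 0 < g.coeff (i + 1) ∧
      IsExpInterpolant c T (d + 1) i f' g' ∧ 0 < g'.coeff i ∧ q = f + f' := by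
  obtain ⟨f, g, hfg, hg⟩ := exists_den_coeff_eq_one (d := d) (i := i + 1) hc hc1.ne (S := T)
    (by omega)
  replace hfg := hfg.smul (p.coeff (i + 1))
  replace hg : (p.coeff (i + 1) • g).coeff (i + 1) = p.coeff (i + 1) := by simp [hg]
  have hsub := (h.mono hT le_rfl le_rfl).sub (hfg.mono subset_rfl (Nat.le_succ d) le_rfl)
  replace hsub : IsExpInterpolant c T (d + 1) i _ _ :=
    ⟨hsub.1, mem_degreeLT_of_coeff_eq_zero hsub.2 (by rw [coeff_sub, hg, sub_self]), hsub.3⟩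
  refine ⟨_, _, _, _, hfg, hg.symm ▸ hp, hsub, ?_, (add_sub_cancel _ _).symm⟩
  rw [hsub.den_coeff_pos_iff hc hc1 (by omega), coeff_sub,
    mem_degreeLT_iff_coeff.1 hfg.num_mem (d + 1) le_rfl, sub_zero]
  exact (h.den_coeff_pos_iff hc hc1 (by omega)).1 hp

theorem eval_pos (h : IsExpInterpolant c S d i q p) (hc : 0 < c) (hc1 : c < 1)
    (hS : S.card = d + i + 1) (hp : 0 < p.coeff i) : ∀ x ∈ S, 0 < q.eval x := by
  induction d generalizing i S q p with
  | zero =>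
    intro x _
    rw [eq_C_of_mem_degreeLT_one h.num_mem]
    simpa using (h.den_coeff_pos_iff hc hc1 hS.ge).1 hp
  | succ d ihd =>
    induction i generalizing S q p with
    | zero =>
      intro x hx
      rw [h.eval_eq x hx, eq_C_of_mem_degreeLT_one h.den_mem, eval_C]
      exact mul_pos (Real.rpow_pos_of_pos hc x) hp
    | succ i ihi =>
      intro x hx
      obtain ⟨y, hy, hyx⟩ := Finset.exists_mem_ne (by omega : 1 < S.card) x
      have hxy : x ∈ S.erase y := Finset.mem_erase.2 ⟨hyx.symm, hx⟩
      have hcard : (S.erase y).card = d + i + 2 := by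
        rw [Finset.card_erase_of_mem hy, hS]; omega
      obtain ⟨f, g, f', g', hf, hg, hf', hg', rfl⟩ :=
        h.exists_eq_add hc hc1 (by omega) hp (Finset.erase_subset y S) hcard
      rw [eval_add]
      exact add_pos (ihd hf (by omega) hg x hxy) (ihi hf' (by omega) hg' x hxy)

theorem den_coeff_pos_of_eval_pos (h : IsExpInterpolant c S d i q p) (hc : 0 < c) (hc1 : c < 1)
    (hS : S.card = d + i + 1) (hx : x ∈ S) (hq : 0 < q.eval x) : 0 < p.coeff i := by
  rcases lt_trichotomy (p.coeff i) 0 with hneg | hzero | hpos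
  · have := (h.smul (-1)).eval_pos hc hc1 hS (by simpa using hneg) x hx
    rw [eval_smul, smul_eq_mul] at this
    linarith
  · rw [(h.eq_zero_of_den_coeff_eq_zero hc hc1.ne hS.ge hzero).1, eval_zero] at hq
    exact absurd hq (lt_irrefl 0)
  · exact hpos

theorem exists_eval_eq_one (hc : 0 < c) (hc1 : c < 1) (hS : S.card = d + i + 1) (hx : x ∈ S) :
    ∃ q p, IsExpInterpolant c S d i q p ∧ q.eval x = 1 := by
  obtain ⟨q, p, h, hp⟩ := exists_den_coeff_eq_one (d := d) (i := i) hc hc1.ne hS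
  have hq := h.eval_pos hc hc1 hS (hp ▸ one_pos) x hx
  exact ⟨_, _, h.smul (q.eval x)⁻¹, by rw [eval_smul, smul_eq_mul, inv_mul_cancel₀ hq.ne']⟩

theorem exists_eq_X_sub_C_mul_of_eval_eq_zero (h : IsExpInterpolant c S (d + 1) (i + 1) q p)
    (hc : 0 < c) (hx : x ∈ S) (h0 : q.eval x = 0) :
    ∃ f g, IsExpInterpolant c (S.erase x) d i f g ∧ q = (X - C x) * f ∧
      g.coeff i = p.coeff (i + 1) := by
  have hp0 : p.eval x = 0 := by
    simpa [h0, (Real.rpow_pos_of_pos hc x).ne'] using h.eval_eq x hx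
  obtain ⟨f, hf, hqf⟩ := exists_mem_degreeLT_eq_X_sub_C_mul h.num_mem h0
  obtain ⟨g, hg, hpg⟩ := exists_mem_degreeLT_eq_X_sub_C_mul h.den_mem hp0
  refine ⟨f, g, ⟨hf, hg, fun y hy => ?_⟩, hqf, ?_⟩
  · have heval := h.eval_eq y (Finset.mem_of_mem_erase hy)
    rw [hqf, hpg, eval_mul, eval_mul, eval_sub, eval_X, eval_C, mul_left_comm] at heval
    exact mul_left_cancel₀ (sub_ne_zero.2 (Finset.ne_of_mem_erase hy)) heval
  · rw [hpg, sub_mul, coeff_sub, coeff_X_mul, coeff_C_mul,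
      mem_degreeLT_iff_coeff.1 hg (i + 1) le_rfl, mul_zero, sub_zero]

theorem exists_sub_eq_X_sub_C_mul (h : IsExpInterpolant c S (d + 1) i q p)
    (h' : IsExpInterpolant c S d (i + 1) q' p') (hc : 0 < c) (hc1 : c < 1)
    (hS : S.card = d + i + 2) (hx : x ∈ S) (hq : q.eval x = 1) (hq' : q'.eval x = 1) :
    ∃ f g, IsExpInterpolant c (S.erase x) d i f g ∧ q' - q = (X - C x) * f ∧
      ∀ y ∈ S.erase x, 0 < f.eval y := by
  obtain ⟨f, g, hfg, hsub, hg⟩ := ((h'.mono subset_rfl (Nat.le_succ d) le_rfl).sub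
    (h.mono subset_rfl le_rfl (Nat.le_succ i))).exists_eq_X_sub_C_mul_of_eval_eq_zero hc hx
    (by rw [eval_sub, hq, hq', sub_self])
  refine ⟨f, g, hfg, hsub, hfg.eval_pos hc hc1 ?_ ?_⟩
  · rw [Finset.card_erase_of_mem hx]; omega
  · rw [hg, coeff_sub, mem_degreeLT_iff_coeff.1 h.den_mem (i + 1) le_rfl, sub_zero]
    exact h'.den_coeff_pos_of_eval_pos hc hc1 (by omega) hx (hq' ▸ one_pos)

theorem div_eval_lt_div_eval (h : IsExpInterpolant c S (d + 1) i q p)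
    (h' : IsExpInterpolant c S d (i + 1) q' p') (hc : 0 < c) (hc1 : c < 1)
    (hS : S.card = d + i + 2) (hx : x ∈ S) (hy : y ∈ S) (hxy : x < y) (hq : 0 < q.eval x)
    (hq' : 0 < q'.eval x) : q.eval y / q.eval x < q'.eval y / q'.eval x := by
  obtain ⟨f, -, -, hsub, hpos⟩ := (h.smul (q.eval x)⁻¹).exists_sub_eq_X_sub_C_mul
    (h'.smul (q'.eval x)⁻¹) hc hc1 hS hx (by rw [eval_smul, smul_eq_mul, inv_mul_cancel₀ hq.ne'])
    (by rw [eval_smul, smul_eq_mul, inv_mul_cancel₀ hq'.ne'])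
  replace hsub := congrArg (eval y) hsub
  rw [eval_sub, eval_mul, eval_sub, eval_X, eval_C, eval_smul, eval_smul, smul_eq_mul,
    smul_eq_mul, inv_mul_eq_div, inv_mul_eq_div] at hsub
  linarith [mul_pos (sub_pos.2 hxy) (hpos y (Finset.mem_erase.2 ⟨hxy.ne', hy⟩))]

theorem eval_lt_eval (h : IsExpInterpolant c S (d + 1) i q p)
    (h' : IsExpInterpolant c S d (i + 1) q' p') (hc : 0 < c) (hc1 : c < 1)
    (hS : S.card = d + i + 2) (hx : x ∈ S) (hy : y ∈ S) (hxy : x < y) (hq : q.eval x = 1)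
    (hq' : q'.eval x = 1) : q.eval y < q'.eval y := by
  simpa [hq, hq'] using h.div_eval_lt_div_eval h' hc hc1 hS hx hy hxy
    (hq ▸ one_pos) (hq' ▸ one_pos)

end IsExpInterpolant

section Corner

variable {c : ℝ} {S : Finset ℝ} {d i : ℕ} {q p : ℝ[X]} {r : ℕ → ℝ} {n : ℕ}

/-- The first `n + 1` exponents, as interpolation nodes. -/
noncomputable def nodes (r : ℕ → ℝ) (n : ℕ) : Finset ℝ := (Finset.range (n + 1)).image r

theorem mem_nodes {j : ℕ} (hj : j ≤ n) : r j ∈ nodes r n :=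
  Finset.mem_image_of_mem r (Finset.mem_range.2 (Nat.lt_succ_of_le hj))

theorem card_nodes (hr : r.Injective) : (nodes r n).card = n + 1 := by
  rw [nodes, Finset.card_image_of_injective _ hr, Finset.card_range]

theorem nodes_succ_erase (hr : r.Injective) :
    (nodes r (n + 1)).erase (r (n + 1)) = nodes r n := by
  rw [nodes, nodes, Finset.range_add_one (n := n + 1), Finset.image_insert, Finset.erase_insert]
  simp [hr.eq_iff]

theorem exists_isExpInterpolant_nodes (h0 : r 0 = 0) (hr : StrictMono r) (hc : 0 < c) (hc1 : c < 1)
    (hi : i ≤ n) : ∃ q p, IsExpInterpolant c (nodes r n) (n - i) i q p ∧ q.eval 0 = 1 :=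
  IsExpInterpolant.exists_eval_eq_one hc hc1 (by rw [card_nodes hr.injective]; omega)
    (h0 ▸ mem_nodes (Nat.zero_le n))

/-- The polynomial `∏ (1 - X / r l)` over `j < l ≤ n`. Its value at an exponent `s` of the Müntz
space is the `j`-th Chebyshev–Bézier control point of `t ^ s` over `[0, 1]`, so these polynomials
are the corners of the control polygons from which those over `[a, b]` are cut. -/
noncomputable def cornerPoly (r : ℕ → ℝ) (j n : ℕ) : ℝ[X] :=
  ∏ l ∈ Finset.Ioc j n, (1 - C (r l)⁻¹ * X)

theorem eval_cornerPoly (j : ℕ) (s : ℝ) :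
    (cornerPoly r j n).eval s = ∏ l ∈ Finset.Ioc j n, (1 - s / r l) := by
  simp [cornerPoly, eval_prod, div_eq_inv_mul]

theorem cornerPoly_succ {j : ℕ} (hj : j ≤ n) :
    cornerPoly r j (n + 1) = (1 - C (r (n + 1))⁻¹ * X) * cornerPoly r j n := by
  rw [cornerPoly, Finset.prod_Ioc_succ_top hj, mul_comm, cornerPoly]

theorem eval_cornerPoly_eq_zero {j s : ℕ} (hjs : j < s) (hs : s ≤ n) (hrs : r s ≠ 0) :
    (cornerPoly r j n).eval (r s) = 0 := by
  rw [eval_cornerPoly]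
  exact Finset.prod_eq_zero (Finset.mem_Ioc.2 ⟨hjs, hs⟩) (by rw [div_self hrs, sub_self])

theorem one_sub_div_nonneg (h0 : 0 ≤ r 0) (hr : StrictMono r) {s l : ℕ} (hsl : s ≤ l) :
    0 ≤ 1 - r s / r l :=
  sub_nonneg.2 (div_le_one_of_le₀ (hr.monotone hsl) (h0.trans (hr.monotone (Nat.zero_le l))))

theorem eval_cornerPoly_nonneg (h0 : 0 ≤ r 0) (hr : StrictMono r) {s : ℕ} (hs : s ≤ n) (j : ℕ) :
    0 ≤ (cornerPoly r j n).eval (r s) := by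
  rcases lt_or_ge j s with hjs | hsj
  · exact (eval_cornerPoly_eq_zero hjs hs (h0.trans_lt (hr (by omega))).ne').ge
  · rw [eval_cornerPoly]
    exact Finset.prod_nonneg fun l hl =>
      one_sub_div_nonneg h0 hr (hsj.trans (Finset.mem_Ioc.1 hl).1.le)

/-- Corner cutting: `β` is the weight for which `q - β q'` vanishes at `y`. -/
theorem IsExpInterpolant.exists_eq_smul_add_smul (h : IsExpInterpolant c S (d + 1) i q p)
    (hc : 0 < c) (hc1 : c < 1) (hS : S.card = d + i + 2) (h0 : 0 ∈ S) {y : ℝ} (hy : y ∈ S)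
    (hypos : 0 < y) (hq : q.eval 0 = 1) :
    ∃ (β : ℝ) (q' p' f g : ℝ[X]), 0 < β ∧ β < 1 ∧
      IsExpInterpolant c S d (i + 1) q' p' ∧ q'.eval 0 = 1 ∧
      IsExpInterpolant c (S.erase y) d i f g ∧ f.eval 0 = 1 ∧
      q = β • q' + (1 - β) • ((1 - C y⁻¹ * X) * f) := by
  obtain ⟨q', p', h', hq'⟩ := exists_eval_eq_one (d := d) (i := i + 1) hc hc1 (by omega) h0
  have hlt : q.eval y < q'.eval y := h.eval_lt_eval h' hc hc1 hS h0 hy hypos hq hq'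
  have hqy : 0 < q.eval y := h.eval_pos hc hc1 (by omega)
    (h.den_coeff_pos_of_eval_pos hc hc1 (by omega) h0 (hq ▸ one_pos)) y hy
  set β := q.eval y / q'.eval y with hβ
  have hβ1 : β < 1 := (div_lt_one (hqy.trans hlt)).2 hlt
  obtain ⟨f, g, hfg, hf, -⟩ := ((h.mono subset_rfl le_rfl (Nat.le_succ i)).sub
    ((h'.mono subset_rfl (Nat.le_succ d) le_rfl).smul β)).exists_eq_X_sub_C_mul_of_eval_eq_zero
    hc hy (by rw [eval_sub, eval_smul, smul_eq_mul, hβ, div_mul_cancel₀ _ (hqy.trans hlt).ne',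
      sub_self])
  have hf0 : 1 - β = -(y * f.eval 0) := by simpa [hq, hq'] using congrArg (eval 0) hf
  have hf0ne : f.eval 0 ≠ 0 := fun hzero => by
    rw [hzero, mul_zero, neg_zero] at hf0
    linarith
  refine ⟨β, q', p', _, _, div_pos hqy (hqy.trans hlt), hβ1, h', hq', hfg.smul (f.eval 0)⁻¹,
    by rw [eval_smul, smul_eq_mul, inv_mul_cancel₀ hf0ne], ?_⟩
  have hCC : C y * C y⁻¹ = 1 := by rw [← C_mul, mul_inv_cancel₀ hypos.ne', C_1]
  rw [eq_add_of_sub_eq' hf, hf0, mul_smul_comm, smul_smul, ← neg_mul,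
    mul_inv_cancel_right₀ hf0ne, smul_eq_C_mul (-y), C_neg]
  linear_combination -(X * f) * hCC

/-- The control polygon over `[a, b]`, with `c = a / b`, arises by corner cutting from the polygon
over `[0, b]`. -/
theorem IsExpInterpolant.mem_convexHull_cornerPoly (h0 : r 0 = 0) (hr : StrictMono r) (hc : 0 < c)
    (hc1 : c < 1) (h : IsExpInterpolant c (nodes r (d + i)) d i q p) (hq : q.eval 0 = 1) :
    q ∈ convexHull ℝ ((cornerPoly r · (d + i)) '' Set.Iic (d + i)) := by
  induction d generalizing i q p with
  | zero =>
    refine subset_convexHull ℝ _ ⟨0 + i, Set.self_mem_Iic, ?_⟩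
    have hC := eq_C_of_mem_degreeLT_one h.num_mem
    rw [hC, eval_C] at hq
    simpa [cornerPoly, hq] using hC.symm
  | succ d ih =>
    obtain ⟨β, q', p', f, g, hβ, hβ1, h', hq', hfg, hf0, rfl⟩ :=
      h.exists_eq_smul_add_smul hc hc1 (by rw [card_nodes hr.injective]; ring)
        (h0 ▸ mem_nodes (Nat.zero_le _)) (mem_nodes le_rfl) (h0 ▸ hr (by omega)) hq
    have hn : d + 1 + i = d + i + 1 := by ring
    rw [hn, nodes_succ_erase hr.injective] at hfg
    rw [hn] at h' ⊢
    set corners := (cornerPoly r · (d + i + 1)) '' Set.Iic (d + i + 1) with hcorners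
    have hmem' : q' ∈ convexHull ℝ corners := by
      rw [hcorners, add_assoc]
      exact ih (by rwa [← add_assoc]) hq'
    have hmem : (1 - C (r (d + i + 1))⁻¹ * X) * f ∈ convexHull ℝ corners := by
      have himage := Set.mem_image_of_mem (LinearMap.mulLeft ℝ (1 - C (r (d + i + 1))⁻¹ * X))
        (ih hfg hf0)
      rw [LinearMap.image_convexHull, Set.image_image] at himage
      refine convexHull_mono ?_ himage
      rintro _ ⟨j, hj, rfl⟩
      exact ⟨j, Nat.le_succ_of_le hj, cornerPoly_succ hj⟩
    exact convex_convexHull ℝ corners hmem' hmem hβ.le (sub_nonneg.2 hβ1.le) (add_sub_cancel _ _)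

/-- The left-hand side is a convex function of `q`, hence largest at a corner. -/
theorem IsExpInterpolant.exists_rpow_eval_sub_le (h0 : r 0 = 0) (hr : StrictMono r) (hc : 0 < c)
    (hc1 : c < 1) (h : IsExpInterpolant c (nodes r (d + i)) d i q p) (hq : q.eval 0 = 1)
    {s : ℕ} (hs : s ≤ d + i) {τ : ℝ} (hτ : 1 ≤ τ) (t : ℝ) :
    ∃ j, q.eval (r s) ^ τ - q.eval t ≤
      (cornerPoly r j (d + i)).eval (r s) ^ τ - (cornerPoly r j (d + i)).eval t := by
  have hconvex := (convexOn_rpow hτ).comp_linearMap (leval (R := ℝ) (r s))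
  have hlin : ConcaveOn ℝ (leval (R := ℝ) (r s) ⁻¹' Set.Ici 0) (leval (R := ℝ) t) :=
    LinearMap.concaveOn _ hconvex.1
  have hconv := hconvex.sub hlin
  obtain ⟨_, ⟨j, -, rfl⟩, hle⟩ := hconv.exists_ge_of_mem_convexHull
    (by rintro _ ⟨j, -, rfl⟩; exact eval_cornerPoly_nonneg h0.ge hr hs j)
    (h.mem_convexHull_cornerPoly h0 hr hc hc1 hq)
  exact ⟨j, hle⟩

end Corner

section Polygon

namespace IsExpInterpolant

variable {c : ℝ} {S : Finset ℝ} {d i : ℕ} {q₀ p₀ q₁ p₁ q₂ p₂ : ℝ[X]} {x y : ℝ}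

theorem slope_le_slope (h₀ : IsExpInterpolant c S (d + 2) i q₀ p₀)
    (h₁ : IsExpInterpolant c S (d + 1) (i + 1) q₁ p₁) (h₂ : IsExpInterpolant c S d (i + 2) q₂ p₂)
    (hc : 0 < c) (hc1 : c < 1) (hS : S.card = d + i + 3) (h0 : 0 ∈ S) (hx : x ∈ S) (hy : y ∈ S)
    (hx0 : 0 < x) (hxy : x < y) (hq₀ : q₀.eval 0 = 1) (hq₁ : q₁.eval 0 = 1) (hq₂ : q₂.eval 0 = 1) :
    (q₁.eval y - q₀.eval y) / (q₁.eval x - q₀.eval x) ≤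
      (q₂.eval y - q₁.eval y) / (q₂.eval x - q₁.eval x) := by
  obtain ⟨f, g, hf, hsub, hfpos⟩ := h₀.exists_sub_eq_X_sub_C_mul h₁ hc hc1 (by omega) h0 hq₀ hq₁
  obtain ⟨f', g', hf', hsub', hfpos'⟩ :=
    h₁.exists_sub_eq_X_sub_C_mul h₂ hc hc1 (by omega) h0 hq₁ hq₂
  have hx' : x ∈ S.erase 0 := Finset.mem_erase.2 ⟨hx0.ne', hx⟩
  have hy' : y ∈ S.erase 0 := Finset.mem_erase.2 ⟨(hx0.trans hxy).ne', hy⟩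
  have hlt := hf.div_eval_lt_div_eval hf' hc hc1
    (by rw [Finset.card_erase_of_mem h0]; omega) hx' hy' hxy (hfpos x hx') (hfpos' x hx')
  simp only [← eval_sub, hsub, hsub', eval_mul, eval_X, C_0, sub_zero, mul_div_mul_comm]
  exact mul_le_mul_of_nonneg_left hlt.le (div_pos (hx0.trans hxy) hx0).le

end IsExpInterpolant

theorem exists_subgradient_of_slope_le {u v : ℕ → ℝ} {m : ℕ} (hu : ∀ s < m, u s < u (s + 1))
    (hv : ∀ s, s + 1 < m → (v (s + 1) - v s) / (u (s + 1) - u s) ≤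
      (v (s + 2) - v (s + 1)) / (u (s + 2) - u (s + 1))) {i : ℕ} (hi : i < m) :
    ∃ σ : ℝ, ∀ j ≤ m, v i + σ * (u j - u i) ≤ v j := by
  set σ : ℕ → ℝ := fun s => (v (s + 1) - v s) / (u (s + 1) - u s)
  have hstep : ∀ s < m, v (s + 1) - v s = σ s * (u (s + 1) - u s) := fun s hs =>
    (div_mul_cancel₀ _ (sub_pos.2 (hu s hs)).ne').symm
  have hmono : ∀ s t, s ≤ t → t < m → σ s ≤ σ t := by
    intro s t hst
    induction t, hst using Nat.le_induction with
    | base => exact fun _ => le_rfl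
    | succ t _ ih => exact fun ht => (ih (by omega)).trans (hv t ht)
  refine ⟨σ i, fun j hj => ?_⟩
  rcases le_total i j with hij | hji
  · induction j, hij using Nat.le_induction with
    | base => simp
    | succ j hij ih =>
      have hslope := mul_le_mul_of_nonneg_right (hmono i j hij (by omega))
        (sub_pos.2 (hu j (by omega))).le
      linarith [ih (by omega), hstep j (by omega)]
  · induction hji using Nat.decreasingInduction with
    | self => simp
    | of_succ j hji ih =>
      have hslope := mul_le_mul_of_nonneg_right (hmono j i (by omega) hi)
        (sub_pos.2 (hu j (by omega))).le
      linarith [ih (by omega), hstep j (by omega)]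

theorem exists_subgradient_eval {c : ℝ} {S : Finset ℝ} {m : ℕ} {x y : ℝ} (hc : 0 < c) (hc1 : c < 1)
    (hS : S.card = m + 1) (h0 : 0 ∈ S) (hx : x ∈ S) (hy : y ∈ S) (hx0 : 0 < x) (hxy : x < y)
    {Q P : ℕ → ℝ[X]} (hQ : ∀ s ≤ m, IsExpInterpolant c S (m - s) s (Q s) (P s))
    (hQ0 : ∀ s ≤ m, (Q s).eval 0 = 1) {i : ℕ} (hi : i < m) :
    ∃ σ : ℝ, ∀ l ≤ m,
      (Q i).eval y + σ * ((Q l).eval x - (Q i).eval x) ≤ (Q l).eval y := by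
  refine exists_subgradient_of_slope_le (u := fun s => (Q s).eval x) (v := fun s => (Q s).eval y)
    (fun s hs => ?_) (fun s hs => ?_) hi
  · obtain ⟨d, rfl⟩ : ∃ d, m = d + 1 + s := ⟨m - s - 1, by omega⟩
    have h := hQ s hs.le
    have h' := hQ (s + 1) hs
    rw [show d + 1 + s - s = d + 1 by omega] at h
    rw [show d + 1 + s - (s + 1) = d by omega] at h'
    exact h.eval_lt_eval h' hc hc1 (by omega) h0 hx hx0 (hQ0 s hs.le) (hQ0 _ hs)
  · obtain ⟨d, rfl⟩ : ∃ d, m = d + 2 + s := ⟨m - s - 2, by omega⟩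
    have h := hQ s (by omega)
    have h' := hQ (s + 1) (by omega)
    have h'' := hQ (s + 2) (by omega)
    rw [show d + 2 + s - s = d + 2 by omega] at h
    rw [show d + 2 + s - (s + 1) = d + 1 by omega] at h'
    rw [show d + 2 + s - (s + 2) = d by omega] at h''
    exact h.slope_le_slope h' h'' hc hc1 (by omega) h0 hx hy hx0 hxy (hQ0 _ (by omega))
      (hQ0 _ (by omega)) (hQ0 _ (by omega))

end Polygon


section EulerEval

variable {r : ℕ → ℝ} {m : ℕ} {a b x : ℝ} {q p : ℝ[X]}

/-- The basis `t ^ r 0, …, t ^ r m` of the Müntz space. -/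
noncomputable def powerBasis (hr : StrictMono r) (m : ℕ) :
    Module.Basis (Fin (m + 1)) ℝ (MuntzSpace r m) :=
  Module.Basis.span (linearIndependent_powers hr)

theorem powerBasis_apply (hr : StrictMono r) (j : Fin (m + 1)) :
    powerBasis hr m j = muntzPower r (Nat.lt_succ_iff.1 j.2) :=
  Module.Basis.span_apply (linearIndependent_powers hr) j

/-- The functional `f ↦ (q(θ) f)(x)` on the Müntz space, where `θ = t d/dt` is the Euler operator,
of which `t ^ s` is an eigenfunction with eigenvalue `s`. It turns differential functionals at the
end points into polynomials: the control points of `f` over `[a, b]` are its values at `x = b`, with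
`q` the numerator of an interpolant of `(a / b) ^ s` at the exponents. -/
noncomputable def eulerEval (hr : StrictMono r) (x : ℝ) (q : ℝ[X]) : MuntzSpace r m →ₗ[ℝ] ℝ :=
  (powerBasis hr m).constr ℝ fun j => q.eval (r j) * x ^ r j

theorem eulerEval_muntzPower (hr : StrictMono r) (x : ℝ) (q : ℝ[X]) {j : ℕ} (hj : j ≤ m) :
    eulerEval hr x q (muntzPower r hj) = q.eval (r j) * x ^ r j := by
  have h := (powerBasis hr m).constr_basis ℝ (fun j => q.eval (r j) * x ^ r j)
    ⟨j, Nat.lt_succ_of_le hj⟩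
  rwa [powerBasis_apply] at h

theorem eulerEval_of_powerSum_eq (hr : StrictMono r) (x : ℝ) (q : ℝ[X]) {f : MuntzSpace r m}
    {c : Fin (m + 1) → ℝ} (hf : powerSum r m c = f) :
    eulerEval hr x q f = ∑ j, c j * q.eval (r j) * x ^ r j := by
  have hsum : f = ∑ j, c j • powerBasis hr m j := by
    refine Subtype.ext (hf.symm.trans ?_)
    ext t
    simp [powerSum, powerBasis_apply, muntzPower]
  rw [hsum, map_sum]
  refine Finset.sum_congr rfl fun j _ => ?_
  rw [map_smul, powerBasis_apply, eulerEval_muntzPower, smul_eq_mul, mul_assoc]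

theorem eulerEval_eq_coeff_mul (hr : StrictMono r) (hx : 0 < x) {f : MuntzSpace r m} {l : ℕ}
    (hf : ∀ j < l, iteratedDeriv j (f : ℝ → ℝ) x = 0) (hp : p ∈ degreeLT ℝ (l + 1)) :
    eulerEval hr x p f = p.coeff l * (x ^ l * iteratedDeriv l (f : ℝ → ℝ) x) := by
  obtain ⟨c, hc⟩ := mem_muntzSpace_iff.1 f.2
  set lower := p - C (p.coeff l) * descPochhammer ℝ l with hlower
  have hmonic : (descPochhammer ℝ l).coeff l = 1 := by
    simpa only [Monic, leadingCoeff, descPochhammer_natDegree] using monic_descPochhammer ℝ l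
  have hmem : descPochhammer ℝ l ∈ degreeLT ℝ (l + 1) := by
    rw [mem_degreeLT, degree_eq_natDegree (monic_descPochhammer ℝ l).ne_zero,
      descPochhammer_natDegree]
    exact_mod_cast Nat.lt_succ_self l
  have hlowerMem : lower ∈ degreeLT ℝ l := by
    rw [hlower, ← smul_eq_C_mul]
    exact mem_degreeLT_of_coeff_eq_zero (sub_mem hp (Submodule.smul_mem _ _ hmem))
      (by rw [coeff_sub, coeff_smul, hmonic, smul_eq_mul, mul_one, sub_self])
  have hzero := sum_eval_eq_zero c hx l (by rwa [hc]) lower (mem_degreeLT.1 hlowerMem)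
  rw [eulerEval_of_powerSum_eq hr x p hc, ← hc, iteratedDeriv_powerSum c hx l, Finset.mul_sum,
    ← sub_eq_zero, ← Finset.sum_sub_distrib, ← hzero]
  refine Finset.sum_congr rfl fun j _ => ?_
  rw [hlower, eval_sub, eval_mul, eval_C]
  ring

theorem eulerEval_eq_zero (hr : StrictMono r) (hx : 0 < x) {f : MuntzSpace r m} {l : ℕ}
    (hf : ∀ j < l, iteratedDeriv j (f : ℝ → ℝ) x = 0) (hp : p ∈ degreeLT ℝ l) :
    eulerEval hr x p f = 0 := by
  rw [eulerEval_eq_coeff_mul hr hx hf (degreeLT_mono (Nat.le_succ l) hp),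
    mem_degreeLT_iff_coeff.1 hp l le_rfl, zero_mul]

theorem IsExpInterpolant.eulerEval_eq {d i : ℕ}
    (h : IsExpInterpolant (a / b) (nodes r m) d i q p) (hr : StrictMono r) (ha : 0 < a)
    (hb : 0 < b) : (eulerEval hr b q : MuntzSpace r m →ₗ[ℝ] ℝ) = eulerEval hr a p := by
  refine (powerBasis hr m).ext fun j => ?_
  rw [powerBasis_apply, eulerEval_muntzPower, eulerEval_muntzPower,
    h.eval_eq _ (mem_nodes (Nat.lt_succ_iff.1 j.2)), Real.div_rpow ha.le hb.le, mul_right_comm,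
    div_mul_cancel₀ _ (Real.rpow_pos_of_pos hb _).ne', mul_comm]

namespace IsChebyshevBernsteinBasis

variable {B : Module.Basis (Fin (m + 1)) ℝ (MuntzSpace r m)}

theorem sum_eq_muntzPower_zero (hB : IsChebyshevBernsteinBasis a b B) (h0 : r 0 = 0) :
    ∑ l, B l = muntzPower r (Nat.zero_le m) := by
  refine Subtype.ext ?_
  ext t
  simp [muntzPower, h0, hB.2 t]

/-- Hermite duality between the basis and the interpolants: the numerator bounds the number of zeros
at `b` and the denominator that of zeros at `a`. -/
theorem coord_eq_eulerEval (hB : IsChebyshevBernsteinBasis a b B) (h0 : r 0 = 0)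
    (hr : StrictMono r) (ha : 0 < a) (hb : 0 < b) {i : Fin (m + 1)}
    (h : IsExpInterpolant (a / b) (nodes r m) (m - i) i q p) (hq : q.eval 0 = 1) :
    B.coord i = eulerEval hr b q := by
  have hoff : ∀ l, l ≠ i → eulerEval hr b q (B l) = 0 := fun l hl => by
    rcases lt_or_gt_of_ne hl with hlt | hgt
    · exact eulerEval_eq_zero hr hb (hB.1 l).2.1 (degreeLT_mono (by lia) h.num_mem)
    · rw [h.eulerEval_eq hr ha hb]
      exact eulerEval_eq_zero hr ha (hB.1 l).1.1 (degreeLT_mono (by lia) h.den_mem)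
  have hdiag : eulerEval hr b q (B i) = 1 := by
    have hone := eulerEval_muntzPower hr b q (Nat.zero_le m)
    rw [← hB.sum_eq_muntzPower_zero h0, map_sum,
      Finset.sum_eq_single i (fun l _ hl => hoff l hl) (by simp), h0, hq] at hone
    simpa using hone
  refine B.ext fun l => ?_
  rcases eq_or_ne l i with rfl | hl
  · simp [hdiag]
  · simp [hoff l hl, hl]

theorem repr_muntzPower (hB : IsChebyshevBernsteinBasis a b B) (h0 : r 0 = 0)
    (hr : StrictMono r) (ha : 0 < a) (hb : 0 < b) {i : Fin (m + 1)}
    (h : IsExpInterpolant (a / b) (nodes r m) (m - i) i q p) (hq : q.eval 0 = 1) {j : ℕ}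
    (hj : j ≤ m) : B.repr (muntzPower r hj) i = q.eval (r j) * b ^ r j := by
  rw [← Module.Basis.coord_apply, hB.coord_eq_eulerEval h0 hr ha hb h hq, eulerEval_muntzPower]

end IsChebyshevBernsteinBasis

end EulerEval

section BasisPositivity

theorem eventually_pos_of_iteratedDeriv_pos {f : ℝ → ℝ} {s : Set ℝ} {a : ℝ} {l : ℕ}
    (hs : IsOpen s) (ha : a ∈ s) (hf : ContDiffOn ℝ (⊤ : ℕ∞) f s)
    (hz : ∀ j < l, iteratedDeriv j f a = 0) (hpos : 0 < iteratedDeriv l f a) :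
    ∀ᶠ t in 𝓝[>] a, 0 < f t := by
  induction l generalizing f with
  | zero =>
    rw [iteratedDeriv_zero] at hpos
    exact nhdsWithin_le_nhds
      ((hf.continuousOn.continuousAt (hs.mem_nhds ha)).eventually (lt_mem_nhds hpos))
  | succ l ih =>
    have hderiv : ∀ᶠ t in 𝓝[>] a, t ∈ s ∧ 0 < deriv f t :=
      (eventually_mem_set.2 (nhdsWithin_le_nhds (hs.mem_nhds ha))).and <|
        ih (hf.deriv_of_isOpen hs (by simp))
          (fun j hj => by rw [← iteratedDeriv_succ']; exact hz (j + 1) (by omega))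
          (by rwa [← iteratedDeriv_succ'])
    obtain ⟨b, hab, hb⟩ := mem_nhdsGT_iff_exists_Ioo_subset.1 hderiv
    have hmono : StrictMonoOn f (Set.Ico a b) := by
      refine strictMonoOn_of_deriv_pos (convex_Ico a b) (hf.continuousOn.mono fun x hx => ?_)
        fun x hx => ?_
      · rcases hx.1.eq_or_lt with rfl | hax
        · exact ha
        · exact (hb ⟨hax, hx.2⟩).1
      · rw [interior_Ico] at hx
        exact (hb hx).2
    have hfa : f a = 0 := by simpa using hz 0 (Nat.succ_pos l)
    filter_upwards [Ioo_mem_nhdsGT hab] with t ht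
    rw [← hfa]
    exact hmono ⟨le_rfl, hab⟩ ⟨ht.1.le, ht.2⟩ ht.1

namespace IsChebyshevBernsteinBasis

variable {r : ℕ → ℝ} {m : ℕ} {a b t : ℝ} {B : Module.Basis (Fin (m + 1)) ℝ (MuntzSpace r m)}

theorem iteratedDeriv_pos (hB : IsChebyshevBernsteinBasis a b B) (h0 : r 0 = 0)
    (hr : StrictMono r) (ha : 0 < a) (hab : a < b) (l : Fin (m + 1)) :
    0 < iteratedDeriv l (B l : ℝ → ℝ) a := by
  have hb := ha.trans hab
  have hc : a / b < 1 := (div_lt_one hb).2 hab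
  obtain ⟨q, p, h, hq⟩ := exists_isExpInterpolant_nodes h0 hr (div_pos ha hb) hc
    (Nat.lt_succ_iff.1 l.2)
  have hcoord : B.coord l (B l) = p.coeff l * (a ^ (l : ℕ) * iteratedDeriv l (B l : ℝ → ℝ) a) := by
    rw [hB.coord_eq_eulerEval h0 hr ha hb h hq, h.eulerEval_eq hr ha hb,
      eulerEval_eq_coeff_mul hr ha (hB.1 l).1.1 h.den_mem]
  have hcoeff : 0 < p.coeff l := h.den_coeff_pos_of_eval_pos (div_pos ha hb) hc
    (by rw [card_nodes hr.injective]; omega)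
    (h0 ▸ mem_nodes (Nat.zero_le m)) (hq ▸ one_pos)
  have hone : B.coord l (B l) = 1 := by simp
  rw [hcoord] at hone
  exact (mul_pos_iff_of_pos_left (pow_pos ha _)).1
    ((mul_pos_iff_of_pos_left hcoeff).1 (hone ▸ one_pos))

theorem apply_ne_zero (hB : IsChebyshevBernsteinBasis a b B) (hr : StrictMono r) (ha : 0 < a)
    (l : Fin (m + 1)) (ht : t ∈ Set.Ioo a b) : (B l : ℝ → ℝ) t ≠ 0 := by
  intro hzero
  obtain ⟨c, hc⟩ := mem_muntzSpace_iff.1 (B l).2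
  obtain ⟨hza, hzb⟩ := hB.1 l
  rw [← hc] at hza hzb hzero
  have hcoeff := coeff_eq_zero_of_zeros (fun i : Fin (m + 1) => r i) ha (ht.1.trans ht.2)
    Finset.univ (injective_exponents hr).injOn c l (m - l) {t}
    (fun z hz => by rw [Finset.mem_singleton.1 hz]; exact ⟨ht.1, ht.2, hzero⟩)
    (sum_eval_eq_zero c ha _ hza.1) (sum_eval_eq_zero c (ha.trans (ht.1.trans ht.2)) _ hzb.1)
    (by rw [Finset.card_fin, Finset.card_singleton]; omega)
  refine B.ne_zero l (Subtype.ext (hc.symm.trans ?_))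
  ext x
  simp [powerSum, hcoeff]

theorem apply_pos (hB : IsChebyshevBernsteinBasis a b B) (h0 : r 0 = 0) (hr : StrictMono r)
    (ha : 0 < a) (l : Fin (m + 1)) (ht : t ∈ Set.Ioo a b) : 0 < (B l : ℝ → ℝ) t := by
  have hab : a < b := ht.1.trans ht.2
  have hcont : ContDiffOn ℝ (⊤ : ℕ∞) (B l : ℝ → ℝ) (Set.Ioi 0) := fun x hx =>
    (contDiffAt_of_mem (B l).2 hx _).contDiffWithinAt
  have hpos := eventually_pos_of_iteratedDeriv_pos isOpen_Ioi ha hcont (hB.1 l).1.1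
    (hB.iteratedDeriv_pos h0 hr ha hab l)
  obtain ⟨s, hs, hspos⟩ := ((eventually_mem_set.2 (Ioo_mem_nhdsGT hab)).and hpos).exists
  by_contra! hle
  obtain ⟨z, hz, hz0⟩ := isPreconnected_Ioo.intermediate_value ht hs
    (hcont.continuousOn.mono fun x hx => ha.trans hx.1) ⟨hle, hspos.le⟩
  exact hB.apply_ne_zero hr ha l hz hz0

end IsChebyshevBernsteinBasis

end BasisPositivity

section ControlPoints

variable {r : ℕ → ℝ} {m : ℕ} {a b t : ℝ} {B : Module.Basis (Fin (m + 1)) ℝ (MuntzSpace r m)}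

theorem sum_repr_mul_apply (B : Module.Basis (Fin (m + 1)) ℝ (MuntzSpace r m))
    (f : MuntzSpace r m) (t : ℝ) : ∑ l, B.repr f l * (B l : ℝ → ℝ) t = (f : ℝ → ℝ) t := by
  simpa [-Module.Basis.sum_repr] using
    congrArg (fun g : MuntzSpace r m => (g : ℝ → ℝ) t) (B.sum_repr f)

namespace IsChebyshevBernsteinBasis

theorem repr_eq_apply (hB : IsChebyshevBernsteinBasis a b B) {i : Fin (m + 1)}
    (hi : ∀ l ≠ i, (B l : ℝ → ℝ) t = 0) (f : MuntzSpace r m) : B.repr f i = (f : ℝ → ℝ) t := by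
  have hone : (B i : ℝ → ℝ) t = 1 := by
    rw [← hB.2 t, Finset.sum_eq_single i (fun l _ hl => hi l hl) (by simp)]
  rw [← sum_repr_mul_apply B f t, Finset.sum_eq_single i (fun l _ hl => by rw [hi l hl, mul_zero])
    (by simp), hone, mul_one]

theorem repr_zero (hB : IsChebyshevBernsteinBasis a b B) (f : MuntzSpace r m) :
    B.repr f 0 = (f : ℝ → ℝ) a :=
  hB.repr_eq_apply (fun l hl => by
    simpa using (hB.1 l).1.1 0 (Nat.pos_of_ne_zero (Fin.val_ne_zero_iff.2 hl))) f

theorem repr_last (hB : IsChebyshevBernsteinBasis a b B) (f : MuntzSpace r m) :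
    B.repr f (Fin.last m) = (f : ℝ → ℝ) b :=
  hB.repr_eq_apply (fun l hl => by
    simpa using (hB.1 l).2.1 0 (Nat.sub_pos_of_lt (Fin.val_lt_last hl))) f

theorem strictMono_repr_muntzPower (hB : IsChebyshevBernsteinBasis a b B) (h0 : r 0 = 0)
    (hr : StrictMono r) (ha : 0 < a) (hab : a < b) {j : ℕ} (hj : 1 ≤ j) (hjm : j ≤ m) :
    StrictMono (B.repr (muntzPower r hjm)) := by
  have hb := ha.trans hab
  have hc : a / b < 1 := (div_lt_one hb).2 hab
  refine Fin.strictMono_iff_lt_succ.2 fun s => ?_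
  obtain ⟨q, p, h, hq⟩ := exists_isExpInterpolant_nodes h0 hr (div_pos ha hb) hc (i := s) s.2.le
  obtain ⟨q', p', h', hq'⟩ :=
    exists_isExpInterpolant_nodes h0 hr (div_pos ha hb) hc (i := s + 1) s.2
  rw [hB.repr_muntzPower h0 hr ha hb (i := s.castSucc) h hq,
    hB.repr_muntzPower h0 hr ha hb (i := s.succ) h' hq']
  rw [show m - s = m - (s + 1) + 1 by omega] at h
  gcongr
  exact h.eval_lt_eval h' (div_pos ha hb) hc
    (by rw [card_nodes hr.injective]; omega) (h0 ▸ mem_nodes (Nat.zero_le m)) (mem_nodes hjm)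
    (h0 ▸ hr (by omega)) hq hq'

theorem exists_subgradient_repr (hB : IsChebyshevBernsteinBasis a b B) (h0 : r 0 = 0)
    (hr : StrictMono r) (ha : 0 < a) (hab : a < b) {j k : ℕ} (hj : 1 ≤ j) (hjk : j < k)
    (hk : k ≤ m) {i : Fin (m + 1)} (hi : i < Fin.last m) :
    ∃ σ : ℝ, ∀ l, B.repr (muntzPower r hk) i +
      σ * (B.repr (muntzPower r (hjk.le.trans hk)) l - B.repr (muntzPower r (hjk.le.trans hk)) i) ≤
        B.repr (muntzPower r hk) l := by
  have hb := ha.trans hab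
  have hc : a / b < 1 := (div_lt_one hb).2 hab
  choose! Q P hQ using fun (s : ℕ) (hs : s ≤ m) =>
    exists_isExpInterpolant_nodes h0 hr (div_pos ha hb) hc hs
  obtain ⟨σ, hσ⟩ := exists_subgradient_eval (div_pos ha hb) hc
    (card_nodes hr.injective) (h0 ▸ mem_nodes (Nat.zero_le m)) (mem_nodes (hjk.le.trans hk))
    (mem_nodes hk) (h0 ▸ hr (by omega)) (hr hjk) (fun s hs => (hQ s hs).1)
    (fun s hs => (hQ s hs).2) hi
  have hrepr : ∀ (l : Fin (m + 1)) {n : ℕ} (hn : n ≤ m),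
      B.repr (muntzPower r hn) l = (Q l).eval (r n) * b ^ r n := fun l n hn => by
    obtain ⟨h, hq⟩ := hQ l (Nat.lt_succ_iff.1 l.2)
    exact hB.repr_muntzPower h0 hr ha hb h hq hn
  refine ⟨σ * (b ^ r k / b ^ r j), fun l => ?_⟩
  have hl := mul_le_mul_of_nonneg_right (hσ l (Nat.lt_succ_iff.1 l.2))
    (Real.rpow_pos_of_pos hb (r k)).le
  rw [hrepr, hrepr, hrepr, hrepr]
  refine le_of_eq_of_le ?_ hl
  have hbj := (Real.rpow_pos_of_pos hb (r j)).ne'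
  field_simp

theorem repr_le_apply_of_subgradient (hB : IsChebyshevBernsteinBasis a b B) (h0 : r 0 = 0)
    (hr : StrictMono r) (ha : 0 < a) (ht : t ∈ Set.Ioo a b) {f g : MuntzSpace r m}
    {i : Fin (m + 1)} {σ : ℝ}
    (hσ : ∀ l, B.repr g i + σ * (B.repr f l - B.repr f i) ≤ B.repr g l)
    (hf : (f : ℝ → ℝ) t = B.repr f i) : B.repr g i ≤ (g : ℝ → ℝ) t := by
  calc B.repr g i
      = B.repr g i * ∑ l, (B l : ℝ → ℝ) t +
          σ * (∑ l, B.repr f l * (B l : ℝ → ℝ) t - B.repr f i * ∑ l, (B l : ℝ → ℝ) t) := by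
        rw [hB.2 t, sum_repr_mul_apply, hf]; ring
    _ = ∑ l, (B.repr g i + σ * (B.repr f l - B.repr f i)) * (B l : ℝ → ℝ) t := by
        rw [Finset.mul_sum, Finset.mul_sum, ← Finset.sum_sub_distrib, Finset.mul_sum,
          ← Finset.sum_add_distrib]
        exact Finset.sum_congr rfl fun l _ => by ring
    _ ≤ ∑ l, B.repr g l * (B l : ℝ → ℝ) t := Finset.sum_le_sum fun l _ =>
        mul_le_mul_of_nonneg_right (hσ l) (hB.apply_pos h0 hr ha l ht).le
    _ = (g : ℝ → ℝ) t := sum_repr_mul_apply B g t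

theorem repr_muntzPower_le_rpow (hB : IsChebyshevBernsteinBasis a b B) (h0 : r 0 = 0)
    (hr : StrictMono r) (ha : 0 < a) (hab : a < b) {j k : ℕ} (hj : 1 ≤ j) (hjk : j ≤ k)
    (hk : k ≤ m) (i : Fin (m + 1)) :
    B.repr (muntzPower r hk) i ≤ B.repr (muntzPower r (hjk.trans hk)) i ^ (r k / r j) := by
  have hrj : 0 < r j := h0 ▸ hr (by omega)
  have hmuntz : ∀ {n : ℕ} (hn : n ≤ m) (t : ℝ), (muntzPower r hn : ℝ → ℝ) t = t ^ r n :=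
    fun _ _ => rfl
  have hpow : ∀ {t : ℝ}, 0 < t → (t ^ r j) ^ (r k / r j) = t ^ r k := fun ht => by
    rw [← Real.rpow_mul ht.le, mul_div_cancel₀ _ hrj.ne']
  rcases hjk.eq_or_lt with rfl | hjk
  · rw [div_self hrj.ne', Real.rpow_one]
  rcases (Fin.zero_le i).eq_or_lt with rfl | hi0
  · rw [hB.repr_zero, hB.repr_zero, hmuntz, hmuntz, hpow ha]
  rcases (Fin.le_last i).eq_or_lt with rfl | him
  · rw [hB.repr_last, hB.repr_last, hmuntz, hmuntz, hpow (ha.trans hab)]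
  have hmono := hB.strictMono_repr_muntzPower h0 hr ha hab hj (hjk.le.trans hk)
  set η := B.repr (muntzPower r (hjk.le.trans hk)) i
  have hηa : a ^ r j < η := by simpa [hB.repr_zero, hmuntz] using hmono hi0
  have hηb : η < b ^ r j := by simpa [hB.repr_last, hmuntz] using hmono him
  obtain ⟨t, ht, htη⟩ : ∃ t ∈ Set.Ioo a b, t ^ r j = η :=
    intermediate_value_Ioo hab.le
      (fun x _ => (Real.continuousAt_rpow_const x _ (.inr hrj.le)).continuousWithinAt) ⟨hηa, hηb⟩
  obtain ⟨σ, hσ⟩ := hB.exists_subgradient_repr h0 hr ha hab hj hjk hk him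
  rw [← htη, hpow (ha.trans ht.1)]
  exact hB.repr_le_apply_of_subgradient h0 hr ha ht hσ htη

theorem exists_repr_muntzPower_rpow_sub_le (hB : IsChebyshevBernsteinBasis a b B) (h0 : r 0 = 0)
    (hr : StrictMono r) (ha : 0 < a) (hab : a < b) {j k : ℕ} (hj : 1 ≤ j) (hjk : j ≤ k)
    (hk : k ≤ m) (i : Fin (m + 1)) :
    ∃ l, B.repr (muntzPower r (hjk.trans hk)) i ^ (r k / r j) - B.repr (muntzPower r hk) i ≤
      ((cornerPoly r l m).eval (r j) ^ (r k / r j) - (cornerPoly r l m).eval (r k)) *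
        b ^ r k := by
  have hb := ha.trans hab
  have hc : a / b < 1 := (div_lt_one hb).2 hab
  have hrj : 0 < r j := h0 ▸ hr (by omega)
  have him : m - i + i = m := Nat.sub_add_cancel (Nat.lt_succ_iff.1 i.2)
  obtain ⟨q, p, h, hq⟩ := exists_isExpInterpolant_nodes h0 hr (div_pos ha hb) hc
    (Nat.lt_succ_iff.1 i.2)
  have hqpos : 0 < q.eval (r j) := by
    refine h.eval_pos (div_pos ha hb) hc ?_ ?_ _ (mem_nodes (hjk.trans hk))
    · rw [card_nodes hr.injective, him]
    · exact h.den_coeff_pos_of_eval_pos (div_pos ha hb) hc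
        (by rw [card_nodes hr.injective, him]) (h0 ▸ mem_nodes (Nat.zero_le m)) (hq ▸ one_pos)
  obtain ⟨l, hle⟩ := IsExpInterpolant.exists_rpow_eval_sub_le h0 hr (div_pos ha hb) hc
    (d := m - i) (i := i) (by rwa [him]) hq (s := j) (by omega) (τ := r k / r j)
    ((one_le_div hrj).2 (hr.monotone hjk)) (r k)
  rw [him] at hle
  refine ⟨l, le_of_eq_of_le ?_ (mul_le_mul_of_nonneg_right hle (Real.rpow_pos_of_pos hb _).le)⟩
  rw [hB.repr_muntzPower h0 hr ha hb h hq, hB.repr_muntzPower h0 hr ha hb h hq,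
    Real.mul_rpow hqpos.le (Real.rpow_pos_of_pos hb _).le, ← Real.rpow_mul hb.le,
    mul_div_cancel₀ _ hrj.ne', sub_mul]

end IsChebyshevBernsteinBasis

end ControlPoints

section Asymptotics

variable {r : ℕ → ℝ}

theorem tendsto_sum_Ioc_atTop {f : ℕ → ℝ} (hf : ∀ i, 0 ≤ f (i + 1))
    (hsum : ¬ Summable fun i => f (i + 1)) (J : ℕ) :
    Tendsto (fun m => ∑ l ∈ Finset.Ioc J m, f l) atTop atTop := by
  have hrange := (not_summable_iff_tendsto_nat_atTop_of_nonneg hf).1 hsum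
  refine (tendsto_atTop_add_const_right _ (-∑ i ∈ Finset.range J, f (i + 1)) hrange).congr' ?_
  filter_upwards [eventually_ge_atTop J] with m hm
  induction m, hm using Nat.le_induction with
  | base => simp
  | succ m hm ih => rw [Finset.sum_range_succ, Finset.sum_Ioc_succ_top hm, ← ih]; ring

theorem exp_neg_le_one_sub {x ε : ℝ} (hx : 0 ≤ x) (hε : ε ≤ 1) (hxε : x ≤ ε / 2) :
    Real.exp (-((1 + ε) * x)) ≤ 1 - x := by
  have hx1 : 0 < 1 - x := by linarith
  rw [Real.exp_neg, inv_le_comm₀ (Real.exp_pos _) hx1]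
  refine le_trans ?_ (Real.add_one_le_exp ((1 + ε) * x))
  rw [inv_le_iff_one_le_mul₀ hx1]
  nlinarith [mul_nonneg hx (by linarith : 0 ≤ ε / 2 - x), mul_nonneg hx (sub_nonneg.2 hε)]

theorem exp_neg_sub_le (y : ℝ) {ε : ℝ} (hε : 0 ≤ ε) :
    Real.exp (-y) - ε ≤ Real.exp (-((1 + ε) * y)) := by
  have hy : y * Real.exp (-y) ≤ 1 := by
    rw [Real.exp_neg, ← div_eq_mul_inv, div_le_one (Real.exp_pos _)]
    linarith [Real.add_one_le_exp y]
  calc Real.exp (-y) - ε ≤ Real.exp (-y) - ε * (y * Real.exp (-y)) := by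
        linarith [mul_le_of_le_one_right hε hy]
    _ = Real.exp (-y) * (-(ε * y) + 1) := by ring
    _ ≤ Real.exp (-y) * Real.exp (-(ε * y)) := by gcongr; exact Real.add_one_le_exp _
    _ = Real.exp (-((1 + ε) * y)) := by rw [← Real.exp_add]; ring_nf

theorem exp_neg_sum_le_eval_cornerPoly {j m : ℕ} {s ε : ℝ} (hε : ε ≤ 1)
    (hs : ∀ l ∈ Finset.Ioc j m, 0 ≤ s / r l ∧ s / r l ≤ ε / 2) :
    Real.exp (-((1 + ε) * (s * ∑ l ∈ Finset.Ioc j m, 1 / r l))) ≤ (cornerPoly r j m).eval s := by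
  rw [eval_cornerPoly, Finset.mul_sum, Finset.mul_sum, ← Finset.sum_neg_distrib, Real.exp_sum]
  refine Finset.prod_le_prod (fun _ _ => (Real.exp_pos _).le) fun l hl => ?_
  rw [mul_one_div]
  exact exp_neg_le_one_sub (hs l hl).1 hε (hs l hl).2

theorem eval_cornerPoly_le_exp_neg_sum (h0 : 0 ≤ r 0) (hr : StrictMono r) {j m : ℕ} (hjm : j ≤ m)
    (l : ℕ) : (cornerPoly r l m).eval (r j) ≤
      Real.exp (-(r j * ∑ n ∈ Finset.Ioc l m, 1 / r n)) := by
  rcases lt_or_ge l j with hlj | hjl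
  · rw [eval_cornerPoly_eq_zero hlj hjm (h0.trans_lt (hr (by omega))).ne']
    exact (Real.exp_pos _).le
  · rw [eval_cornerPoly, Finset.mul_sum, ← Finset.sum_neg_distrib, Real.exp_sum]
    refine Finset.prod_le_prod (fun n hn =>
      one_sub_div_nonneg h0 hr (hjl.trans (Finset.mem_Ioc.1 hn).1.le)) fun n _ => ?_
    rw [mul_one_div]
    exact Real.one_sub_le_exp_neg _

theorem eval_cornerPoly_rpow_le (h0 : 0 ≤ r 0) (hr : StrictMono r) {j m : ℕ} (hj : 1 ≤ j)
    (hjm : j ≤ m) {t : ℝ} (ht : 0 ≤ t) (l : ℕ) :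
    (cornerPoly r l m).eval (r j) ^ (t / r j) ≤
      Real.exp (-(t * ∑ n ∈ Finset.Ioc l m, 1 / r n)) := by
  have hrj : 0 < r j := h0.trans_lt (hr hj)
  refine (Real.rpow_le_rpow (eval_cornerPoly_nonneg h0 hr hjm l)
    (eval_cornerPoly_le_exp_neg_sum h0 hr hjm l) (by positivity)).trans_eq ?_
  rw [← Real.exp_mul]
  congr 1
  field_simp

/-- For a corner of small index both terms are small, since the Müntz series diverges; for a corner
of large index every factor `1 - r k / r n` is close to `exp (- r k / r n)`. -/
theorem exists_eval_cornerPoly_rpow_sub_le (h0 : 0 ≤ r 0) (hr : StrictMono r)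
    (hlim : Tendsto r atTop atTop) (hmuntz : ¬ Summable fun i => 1 / r (i + 1)) {j k : ℕ}
    (hj : 1 ≤ j) (hjk : j ≤ k) {δ : ℝ} (hδ : 0 < δ) :
    ∃ M, ∀ m, M ≤ m → k ≤ m → ∀ l,
      (cornerPoly r l m).eval (r j) ^ (r k / r j) - (cornerPoly r l m).eval (r k) ≤ δ := by
  have hpos : ∀ {n}, 1 ≤ n → 0 < r n := fun hn => h0.trans_lt (hr hn)
  have hrk := hpos (hj.trans hjk)
  set ε := min δ 1
  have hε : 0 < ε := lt_min hδ one_pos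
  obtain ⟨J, hJ⟩ := eventually_atTop.1 <| (eventually_ge_atTop 1).and <|
    (hlim.const_div_atTop (r k)).eventually_le_const (half_pos hε)
  have hdiv : Tendsto (fun m => Real.exp (-(r k * ∑ n ∈ Finset.Ioc J m, 1 / r n))) atTop (𝓝 0) :=
    Real.tendsto_exp_neg_atTop_nhds_zero.comp <|
      (tendsto_sum_Ioc_atTop (f := fun n => 1 / r n) (fun i => (one_div_pos.2 (hpos i.succ_pos)).le)
        hmuntz J).const_mul_atTop hrk
  obtain ⟨M, hM⟩ := eventually_atTop.1 (hdiv.eventually_le_const hδ)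
  refine ⟨M, fun m hm hkm l => ?_⟩
  have hupper := eval_cornerPoly_rpow_le h0 hr hj (hjk.trans hkm) hrk.le l
  rcases lt_or_ge l J with hlJ | hJl
  · have hhead : ∑ n ∈ Finset.Ioc J m, 1 / r n ≤ ∑ n ∈ Finset.Ioc l m, 1 / r n :=
      Finset.sum_le_sum_of_subset_of_nonneg (Finset.Ioc_subset_Ioc_left hlJ.le) fun n hn _ =>
        (one_div_pos.2 (hpos (by have := (Finset.mem_Ioc.1 hn).1; omega))).le
    have hexp := Real.exp_le_exp.2 (neg_le_neg (mul_le_mul_of_nonneg_left hhead hrk.le))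
    linarith [hM m hm, eval_cornerPoly_nonneg h0 hr hkm l]
  · have hlower := exp_neg_sum_le_eval_cornerPoly (r := r) (j := l) (m := m) (s := r k)
      (min_le_right δ 1) fun n hn => by
        have hJn := hJ n (hJl.trans (Finset.mem_Ioc.1 hn).1.le)
        exact ⟨(div_pos hrk (hpos hJn.1)).le, hJn.2⟩
    linarith [exp_neg_sub_le (r k * ∑ n ∈ Finset.Ioc l m, 1 / r n) hε.le, min_le_left δ 1]

end Asymptotics

end MuntzElevation

theorem theorem7_general (r : ℕ → ℝ) (h0 : r 0 = 0) (hr : StrictMono r)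
    (hlim : Filter.Tendsto r Filter.atTop Filter.atTop)
    (hmuntz : ¬ Summable fun i : ℕ => 1 / r (i + 1))
    (a b : ℝ) (ha : 0 < a) (hab : a < b) (j k : ℕ) (hj : 1 ≤ j) (hjk : j ≤ k) :
    ∀ ε : ℝ, 0 < ε → ∃ M : ℕ, ∀ (m : ℕ) (hkm : k ≤ m), M ≤ m → ∀ i : Fin (m + 1),
      |MuntzElevation.controlPoint h0 hr ha hab
            (MuntzElevation.muntzPower r (hjk.trans hkm)) i ^ (r k / r j)
        - MuntzElevation.controlPoint h0 hr ha hab (MuntzElevation.muntzPower r hkm) i| < ε := by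
  intro ε hε
  have hbk : 0 < b ^ r k := Real.rpow_pos_of_pos (ha.trans hab) _
  obtain ⟨M, hM⟩ := MuntzElevation.exists_eval_cornerPoly_rpow_sub_le h0.ge hr hlim hmuntz hj hjk
    (half_pos (div_pos hε hbk))
  refine ⟨M, fun m hkm hm i => ?_⟩
  have hB := MuntzElevation.isChebyshevBernsteinBasis h0 hr ha hab m
  have hupper := hB.repr_muntzPower_le_rpow h0 hr ha hab hj hjk hkm i
  obtain ⟨l, hlower⟩ := hB.exists_repr_muntzPower_rpow_sub_le h0 hr ha hab hj hjk hkm i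
  rw [MuntzElevation.controlPoint, MuntzElevation.controlPoint, abs_of_nonneg (sub_nonneg.2 hupper)]
  refine (hlower.trans (mul_le_mul_of_nonneg_right (hM m hm hkm l) hbk.le)).trans_lt ?_
  rw [div_right_comm, div_mul_cancel₀ _ hbk.ne']
  exact half_lt_self hε

theorem theorem7 (r : ℕ → ℝ) (h0 : r 0 = 0) (hr : StrictMono r)
    (hlim : Filter.Tendsto r Filter.atTop Filter.atTop)
    (hmuntz : ¬ Summable fun i : ℕ => 1 / r (i + 1))
    (a : ℝ) (ha : 0 < a) (ha1 : a < 1) (k : ℕ) (hk : 1 ≤ k) :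
    ∀ ε : ℝ, 0 < ε → ∃ M : ℕ, ∀ (m : ℕ) (hkm : k ≤ m), M ≤ m → ∀ i : Fin (m + 1),
      |MuntzElevation.controlPoint h0 hr ha ha1
            (MuntzElevation.muntzPower r (hk.trans hkm)) i ^ (r k / r 1)
        - MuntzElevation.controlPoint h0 hr ha ha1 (MuntzElevation.muntzPower r hkm) i| < ε :=
  theorem7_general r h0 hr hlim hmuntz a 1 ha ha1 1 k le_rfl hk
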